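/- Let $n\ge 2$ and let $\mathscr U\subset\mathbb C^n$ be a bounded monomial polyhedron, i.e. a bounded domain (nonempty connected open set) of the form $$\mathscr U=\Big\{z\in\mathbb C^n:\ \prod_{k=1}^n|z_k|^{b^j_k}\ \text{is defined and}\ \prod_{k=1}^n|z_k|^{b^j_k}<1\ \text{ for } 1\le j\le n\Big\},\qquad b^j_k\in\mathbb Q,$$ where the product is undefined if $z_k=0$ and $b^j_k<0$ for some $k$, and $0^0=1$. Let $A^2(\mathscr U)$ be the space of holomorphic functions on $\mathscr U$ that are square integrable with respect to Lebesgue measure $V$. Then $\mathscr U$ has a Bergman kernel $K$, i.e. a function $K:\mathscr U\times\mathscr U\to\mathbb C$ such that, for every $w\in\mathscr U$, $K(\cdot,w)\in A^2(\mathscr U)$ and $f(w)=\int_{\mathscr U}f(z)\overline{K(z,w)}\,dV(z)$ for all $f\in A^2(\mathscr U)$ (such a function is unique), and $K$ is a rational function of $(z,\overline w)$ on $\mathscr U\times\mathscr U$: there are polynomials $P,Q\in\mathbb C[x_1,\dots,x_n,y_1,\dots,y_n]$ such that for all $z,w\in\mathscr U$ $$Q(z,\overline w)\neq 0\quad\text{and}\quad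 K(z,w)=\frac{P(z,\overline w)}{Q(z,\overline w)}.$$ -/

import Mathlib

open MeasureTheory Set
open scoped ComplexConjugate

/-- The set of all `z ∈ ℂⁿ` such that for each row `b j` the quantity `∏ k, |z k| ^ (b j k)` is
defined (zero is never raised to a negative power) and less than `1`.
Here `0 ^ 0 = 1` and `0 ^ t = 0` for `t > 0`. -/
def monomialSublevelSet {n : ℕ} (b : Matrix (Fin n) (Fin n) ℚ) : Set (Fin n → ℂ) :=
  {z | ∀ j, (∀ k, b j k < 0 → z k ≠ 0) ∧ ∏ k, ‖z k‖ ^ ((b j k : ℚ) : ℝ) < 1}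

/-- A monomial polyhedron in `ℂⁿ`: a domain (nonempty connected open set) cut out by `n`
inequalities `∏ k, |z k| ^ (b j k) < 1` with rational exponents. -/
structure IsMonomialPolyhedron {n : ℕ} (U : Set (Fin n → ℂ)) : Prop where
  isOpen : IsOpen U
  isConnected : IsConnected U
  exists_eq : ∃ b : Matrix (Fin n) (Fin n) ℚ, U = monomialSublevelSet b

/-- Membership in the Bergman space `A²(Ω)`: holomorphic on `Ω` and square integrable on `Ω` with
respect to Lebesgue measure. Only the values of `f` on `Ω` matter. -/
structure MemBergmanSpace {n : ℕ} (Ω : Set (Fin n → ℂ)) (f : (Fin n → ℂ) → ℂ) : Prop where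
  differentiableOn : DifferentiableOn ℂ f Ω
  memLp : MemLp f 2 (volume.restrict Ω)

/-- `K` is the reproducing kernel of `A²(Ω)`: for each `w ∈ Ω` the function `K(·, w)` lies in
`A²(Ω)`, and `f w = ∫_Ω f(z) conj(K(z, w)) dV(z)` for every `f ∈ A²(Ω)`. -/
structure IsBergmanKernel {n : ℕ} (Ω : Set (Fin n → ℂ))
    (K : (Fin n → ℂ) → (Fin n → ℂ) → ℂ) : Prop where
  mem : ∀ w ∈ Ω, MemBergmanSpace Ω (fun z => K z w)
  reproducing : ∀ w ∈ Ω, ∀ f : (Fin n → ℂ) → ℂ, MemBergmanSpace Ω f →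
    f w = ∫ z in Ω, f z * conj (K z w)

/-- There is at most one Bergman kernel, as a function on `Ω × Ω`. -/
theorem IsBergmanKernel.unique {n : ℕ} {Ω : Set (Fin n → ℂ)}
    {K₁ K₂ : (Fin n → ℂ) → (Fin n → ℂ) → ℂ}
    (h₁ : IsBergmanKernel Ω K₁) (h₂ : IsBergmanKernel Ω K₂) :
    ∀ z ∈ Ω, ∀ w ∈ Ω, K₁ z w = K₂ z w := by
  have key : ∀ {K L : (Fin n → ℂ) → (Fin n → ℂ) → ℂ}, IsBergmanKernel Ω K →
      IsBergmanKernel Ω L → ∀ z ∈ Ω, ∀ w ∈ Ω, K z w = conj (L w z) := by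
    intro K L hK hL z hz w hw
    rw [hL.reproducing z hz _ (hK.mem w hw), hK.reproducing w hw _ (hL.mem z hz),
      ← integral_conj]
    refine integral_congr_ae (Filter.Eventually.of_forall fun x => ?_)
    simp [mul_comm]
  intro z hz w hw
  rw [key h₁ h₁ z hz w hw, ← key h₂ h₁ z hz w hw]

open Classical in
/-- The Bergman kernel of `Ω`, that is, the function `K` on `Ω × Ω` with `IsBergmanKernel Ω K`
(and zero by convention if there is none). -/
noncomputable def bergmanKernel {n : ℕ} (Ω : Set (Fin n → ℂ)) :
    (Fin n → ℂ) → (Fin n → ℂ) → ℂ :=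
  if h : ∃ K, IsBergmanKernel Ω K then h.choose else 0

/-- The point `(z, conj w)` of `ℂⁿ × ℂⁿ`, at which polynomials in `2n` variables are evaluated. -/
def pairConj {n : ℕ} (z w : Fin n → ℂ) : Fin n ⊕ Fin n → ℂ :=
  Sum.elim z (fun k => conj (w k))

/-- `F` is a rational function on `Ω × Ω` in the sesqui-holomorphic sense: it is a quotient of two
complex polynomials in `z` and `conj w` whose denominator has no zero on `Ω × Ω`. -/
def IsSesquiRationalOn {n : ℕ} (Ω : Set (Fin n → ℂ))
    (F : (Fin n → ℂ) → (Fin n → ℂ) → ℂ) : Prop :=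
  ∃ P Q : MvPolynomial (Fin n ⊕ Fin n) ℂ, ∀ z ∈ Ω, ∀ w ∈ Ω,
    MvPolynomial.eval (pairConj z w) Q ≠ 0 ∧
      F z w = MvPolynomial.eval (pairConj z w) P / MvPolynomial.eval (pairConj z w) Q

/-!
A domain cut out by monomial inequalities is invariant under the torus `Tⁿ` acting coordinatewise,
so Laurent monomials span a dense subspace of its Bergman space, and the Bergman kernel is a sum
over the integer points of a cone. The kernel is rational because that cone is simplicial.

Clearing denominators, the domain is `U = {‖z ^ (G j)‖ < 1 for all j}` with `G` an integer matrix.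
In the coordinates `log ‖z k‖` it becomes the cone `{x | G x < 0}`. If `G` were singular, this cone
would contain lines and `U` would be unbounded (`det_ne_zero_of_isBounded`). Write `s(β) = β G⁻¹`
for the coordinates of an exponent with respect to the rows of `G`. Passing to logarithmic
coordinates, and then to `y = G x`, turns `∫_U |z ^ α|²` into a product of one-dimensional
exponential integrals, which is finite exactly when all `s_j(α + 1)` are positive, and then is `π ^
n / (|det G| ∏ s_j(α + 1))` (`lintegral_sq_laurentMonomial`). The candidate kernel is therefore
`(|det G| / π ^ n) ∑_α (∏ s_j(α + 1)) (z * conj w) ^ α`, over `α` with `s(α + 1) > 0`.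

Rationality: such `α` are uniquely `μ + ∑ m_j (G j)` with `m_j ∈ ℕ` and `μ` in the finite set where
`0 < s_j(μ + 1) ≤ 1`, so the sum is a finite sum of products of series `∑ (s + m) u ^ m`
(`hasSum_coneSum`). The argument `z * conj w` stays in `U`, hence `|u| < 1` and no denominator
vanishes.

Reproducing property: for holomorphic `f` the Fourier coefficients of `t ↦ f (t • z)` are
`a_α z ^ α`. Equivalently, the torus average of `f z / z ^ α` does not depend on `z`; this is
Cauchy–Goursat on a rectangle in the tube over the cone, whose two horizontal sides cancel after
averaging (`torusAverage_expCurve`). If `f` is square integrable, then `a_α = 0` unless `z ^ α` is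
square integrable, and otherwise `a_α` is the inner product of `f` with `z ^ α` divided by
`‖z ^ α‖²`. Integrating `f` against the kernel term by term thus produces the Fourier series of
`t ↦ f (t • w)` at `t = 0`. The series converges absolutely, so its sum is `f w`.
-/

/-! ### Integration in logarithmic coordinates -/

theorem lintegral_pi_prod {n : ℕ} {E : Type*} {mE : MeasurableSpace E}
    (μ : Fin n → Measure E) [∀ i, SigmaFinite (μ i)] {f : Fin n → E → ENNReal}
    (hf : ∀ i, Measurable (f i)) :
    ∫⁻ x, ∏ i, f i (x i) ∂(Measure.pi μ) = ∏ i, ∫⁻ x, f i x ∂(μ i) := by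
  induction n with
  | zero => simp
  | succ n ih =>
    rw [← ((measurePreserving_piFinSuccAbove μ 0).symm).lintegral_comp_emb
      (MeasurableEquiv.measurableEmbedding _)]
    simp_rw [MeasurableEquiv.piFinSuccAbove_symm_apply, Fin.insertNthEquiv,
      Fin.prod_univ_succ, Fin.insertNth_zero]
    simp only [Fin.zero_succAbove]
    rw [← ih (fun i : Fin n => μ i.succ) (fun i : Fin n => hf i.succ)]
    exact lintegral_prod_mul (hf 0).aemeasurable
      (Finset.measurable_prod _ fun (i : Fin n) _ =>
        (hf i.succ).comp (measurable_pi_apply i)).aemeasurable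

theorem pi_withDensity {n : ℕ} {E : Type*} {mE : MeasurableSpace E}
    (μ : Fin n → Measure E) [∀ i, SigmaFinite (μ i)] {f : Fin n → E → ENNReal}
    (hf : ∀ i, Measurable (f i)) [∀ i, SigmaFinite ((μ i).withDensity (f i))] :
    Measure.pi (fun i => (μ i).withDensity (f i)) =
      (Measure.pi μ).withDensity (fun x => ∏ i, f i (x i)) := by
  refine Measure.pi_eq fun s hs => ?_
  rw [withDensity_apply _ (MeasurableSet.univ_pi hs), Measure.restrict_pi_pi,
    lintegral_pi_prod _ hf]
  exact Finset.prod_congr rfl fun i _ => (withDensity_apply _ (hs i)).symm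

/-- The push-forward of Lebesgue measure on `ℂ` under `log ‖·‖` has density `2π exp (2x)`. -/
theorem map_log_norm_volume :
    Measure.map (fun z : ℂ => Real.log ‖z‖) volume =
      volume.withDensity (fun x : ℝ => ENNReal.ofReal (2 * Real.pi * Real.exp (2 * x))) := by
  have hm : Measurable (fun z : ℂ => Real.log ‖z‖) := by fun_prop
  ext A hA
  rw [Measure.map_apply hm hA, withDensity_apply _ hA, ← lintegral_indicator_one (hm hA),
    ← Complex.lintegral_comp_polarCoord_symm, polarCoord_target]
  have h1 : ∀ p : ℝ × ℝ, p ∈ Ioi (0 : ℝ) ×ˢ Ioo (-Real.pi) Real.pi →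
      ENNReal.ofReal p.1 • ((fun z : ℂ => Real.log ‖z‖) ⁻¹' A).indicator (1 : ℂ → ENNReal)
        (Complex.polarCoord.symm p) =
      (ENNReal.ofReal p.1 * A.indicator (1 : ℝ → ENNReal) (Real.log p.1)) * 1 := by
    intro p hp
    have h0 : (0 : ℝ) < p.1 := hp.1
    have : ‖Complex.polarCoord.symm p‖ = p.1 := by
      rw [Complex.norm_polarCoord_symm, abs_of_pos h0]
    have h3 : Complex.polarCoord.symm p ∈ (fun z : ℂ => Real.log ‖z‖) ⁻¹' A ↔
        Real.log p.1 ∈ A := by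
      rw [mem_preimage, this]
    by_cases h4 : Real.log p.1 ∈ A
    · rw [indicator_of_mem h4, indicator_of_mem (h3.2 h4)]; simp
    · rw [indicator_of_notMem h4, indicator_of_notMem (mt h3.1 h4)]; simp
  have hr : Measurable fun r : ℝ =>
      ENNReal.ofReal r * A.indicator (1 : ℝ → ENNReal) (Real.log r) :=
    ENNReal.measurable_ofReal.mul ((measurable_one.indicator hA).comp Real.measurable_log)
  rw [setLIntegral_congr_fun (measurableSet_Ioi.prod measurableSet_Ioo) h1,
    Measure.volume_eq_prod, ← Measure.prod_restrict,
    lintegral_prod_mul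
      (f := fun r : ℝ => ENNReal.ofReal r * A.indicator (1 : ℝ → ENNReal) (Real.log r))
      (g := fun _ => 1) hr.aemeasurable aemeasurable_const]
  have h2 : Ioi (0 : ℝ) = Real.exp '' univ := by rw [image_univ, Real.range_exp]
  rw [h2, lintegral_image_eq_lintegral_abs_deriv_mul MeasurableSet.univ
    (fun x _ => (Real.hasDerivAt_exp x).hasDerivWithinAt) Real.exp_injective.injOn]
  simp only [Measure.restrict_univ, lintegral_one, Measure.restrict_apply_univ, Real.volume_Ioo,
    Real.log_exp]
  rw [mul_comm, ← lintegral_const_mul _ (by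
    exact (by fun_prop : Measurable fun x => ENNReal.ofReal |Real.exp x|).mul
      ((by fun_prop : Measurable fun x => ENNReal.ofReal (Real.exp x)).mul
        (measurable_one.indicator hA))), ← lintegral_indicator hA]
  refine lintegral_congr fun x => ?_
  by_cases hx : x ∈ A
  · simp only [hx, indicator_of_mem, Pi.one_apply, mul_one, abs_of_pos (Real.exp_pos x)]
    rw [← ENNReal.ofReal_mul (Real.exp_pos x).le, ← ENNReal.ofReal_mul (by linarith [Real.pi_pos]),
      two_mul x, Real.exp_add]
    congr 1; ring
  · simp [hx]

theorem lintegral_comp_log_norm {n : ℕ} {g : (Fin n → ℝ) → ENNReal} (hg : Measurable g) :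
    ∫⁻ z : Fin n → ℂ, g (fun k => Real.log ‖z k‖) =
      ∫⁻ x : Fin n → ℝ, (∏ k, ENNReal.ofReal (2 * Real.pi * Real.exp (2 * x k))) * g x := by
  have hm : Measurable (fun z : ℂ => Real.log ‖z‖) := by fun_prop
  have hd : Measurable (fun x : ℝ => ENNReal.ofReal (2 * Real.pi * Real.exp (2 * x))) := by
    fun_prop
  have hs : SigmaFinite ((volume : Measure ℝ).withDensity
      (fun x : ℝ => ENNReal.ofReal (2 * Real.pi * Real.exp (2 * x)))) :=
    SigmaFinite.withDensity_ofReal _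
  have hs' : SigmaFinite (Measure.map (fun z : ℂ => Real.log ‖z‖) volume) := by
    rw [map_log_norm_volume]; exact hs
  have h1 : Measure.map (fun (z : Fin n → ℂ) k => Real.log ‖z k‖) volume =
      volume.withDensity
        (fun x : Fin n → ℝ => ∏ k, ENNReal.ofReal (2 * Real.pi * Real.exp (2 * x k))) := by
    rw [volume_pi, volume_pi, Measure.pi_map_pi (fun _ => hm.aemeasurable)]
    simp_rw [map_log_norm_volume]
    exact pi_withDensity _ (fun _ => hd)
  rw [← lintegral_map (f := g) hg (by fun_prop), h1,
    lintegral_withDensity_eq_lintegral_mul _ (by fun_prop) hg]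
  rfl

theorem lintegral_exp_Iio_of_pos {a : ℝ} (ha : 0 < a) :
    ∫⁻ x in Iio (0 : ℝ), ENNReal.ofReal (Real.exp (a * x)) = ENNReal.ofReal a⁻¹ := by
  rw [setLIntegral_congr Iio_ae_eq_Iic,
    ← ofReal_integral_eq_lintegral_ofReal (integrableOn_exp_mul_Iic ha 0)
      (Filter.Eventually.of_forall fun _ => (Real.exp_pos _).le), integral_exp_mul_Iic ha]
  simp

theorem lintegral_exp_Iio_of_nonpos {a : ℝ} (ha : a ≤ 0) :
    ∫⁻ x in Iio (0 : ℝ), ENNReal.ofReal (Real.exp (a * x)) = ⊤ := by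
  refine top_le_iff.mp ?_
  calc (⊤ : ENNReal) = ∫⁻ x in Iio (0 : ℝ), 1 := by simp
    _ ≤ _ := setLIntegral_mono (by fun_prop) fun x hx => by
      rw [← ENNReal.ofReal_one]
      exact ENNReal.ofReal_le_ofReal
        (Real.one_le_exp (mul_nonneg_of_nonpos_of_nonpos ha (le_of_lt hx)))

/-- The substitution `y = M x` maps the cone onto an orthant, where the integral factors. -/
theorem lintegral_exp_cone {n : ℕ} {M : Matrix (Fin n) (Fin n) ℝ} (hM : M.det ≠ 0)
    (s : Fin n → ℝ) :
    ∫⁻ x in {x : Fin n → ℝ | ∀ j, M.mulVec x j < 0},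
        ENNReal.ofReal (Real.exp (2 * (s ⬝ᵥ M.mulVec x))) =
      ENNReal.ofReal |M.det⁻¹| *
        ∏ j, ∫⁻ x in Iio (0 : ℝ), ENNReal.ofReal (Real.exp (2 * s j * x)) := by
  have hms : MeasurableSet {y : Fin n → ℝ | ∀ j, y j < 0} := by
    measurability
  have hmL : Measurable (Matrix.toLin' M) := (LinearMap.continuous_on_pi _).measurable
  have hF : Measurable fun y : Fin n → ℝ => ENNReal.ofReal (Real.exp (2 * (s ⬝ᵥ y))) := by
    unfold dotProduct; fun_prop
  have h1 : ∫⁻ y in {y : Fin n → ℝ | ∀ j, y j < 0}, ENNReal.ofReal (Real.exp (2 * (s ⬝ᵥ y)))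
        ∂(Measure.map (Matrix.toLin' M) volume) =
      ∫⁻ x in {x : Fin n → ℝ | ∀ j, M.mulVec x j < 0},
        ENNReal.ofReal (Real.exp (2 * (s ⬝ᵥ M.mulVec x))) := by
    rw [setLIntegral_map hms hF hmL]
    rfl
  rw [← h1, Real.map_matrix_volume_pi_eq_smul_volume_pi hM, Measure.restrict_smul,
    lintegral_smul_measure, smul_eq_mul, ← lintegral_pi_prod _ (fun j => by fun_prop)]
  congr 1
  have h2 : {y : Fin n → ℝ | ∀ j, y j < 0} = univ.pi fun _ => Iio 0 := by
    ext; simp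
  rw [h2, volume_pi, Measure.restrict_pi_pi]
  refine lintegral_congr fun y => ?_
  rw [← ENNReal.ofReal_prod_of_nonneg (fun _ _ => (Real.exp_pos _).le), ← Real.exp_sum]
  simp only [dotProduct, Finset.mul_sum, mul_assoc]

/-! ### Laurent monomials and integer exponents -/

/-- The Laurent monomial `z ^ α = ∏ k, z k ^ α k`. With the conventions of `zpow`, a negative power
of a vanishing coordinate is `0`. -/
noncomputable def laurentMonomial {n : ℕ} (α : Fin n → ℤ) (z : Fin n → ℂ) : ℂ := ∏ k, z k ^ α k

/-- The monomial polyhedron with integer exponents: the set where each row `G j` gives a Laurent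
monomial that is defined (no negative power of zero) and of absolute value less than `1`. -/
def integralPolyhedron {n : ℕ} (G : Matrix (Fin n) (Fin n) ℤ) : Set (Fin n → ℂ) :=
  {z | ∀ j, (∀ k, G j k < 0 → z k ≠ 0) ∧ ‖laurentMonomial (G j) z‖ < 1}

theorem norm_laurentMonomial {n : ℕ} (α : Fin n → ℤ) (z : Fin n → ℂ) :
    ‖laurentMonomial α z‖ = ∏ k, ‖z k‖ ^ α k := by
  simp [laurentMonomial, norm_prod, norm_zpow]

theorem laurentMonomial_mul {n : ℕ} (α : Fin n → ℤ) (z w : Fin n → ℂ) :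
    laurentMonomial α (z * w) = laurentMonomial α z * laurentMonomial α w := by
  simp [laurentMonomial, mul_zpow, Finset.prod_mul_distrib]

theorem laurentMonomial_conj {n : ℕ} (α : Fin n → ℤ) (z : Fin n → ℂ) :
    laurentMonomial α (fun k => conj (z k)) = conj (laurentMonomial α z) := by
  simp [laurentMonomial, map_prod, map_zpow₀]

/-- Multiplicativity in the exponent can fail at zero coordinates (`0 ^ (1 + -1) = 1`), so exponents
there must be nonnegative. -/
theorem laurentMonomial_add {n : ℕ} {α β : Fin n → ℤ} {z : Fin n → ℂ}
    (hα : ∀ k, z k = 0 → 0 ≤ α k) (hβ : ∀ k, z k = 0 → 0 ≤ β k) :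
    laurentMonomial (α + β) z = laurentMonomial α z * laurentMonomial β z := by
  simp only [laurentMonomial, ← Finset.prod_mul_distrib, Pi.add_apply]
  refine Finset.prod_congr rfl fun k _ => zpow_add' ?_
  by_cases h : z k = 0
  · have := hα k h
    have := hβ k h
    right; omega
  · exact Or.inl h

theorem laurentMonomial_sum {n : ℕ} {ι : Type*} (s : Finset ι) {γ : ι → Fin n → ℤ}
    {z : Fin n → ℂ} (hγ : ∀ i k, z k = 0 → 0 ≤ γ i k) :
    laurentMonomial (∑ i ∈ s, γ i) z = ∏ i ∈ s, laurentMonomial (γ i) z := by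
  classical
  induction s using Finset.induction_on with
  | empty => simp [laurentMonomial]
  | insert a s ha ih =>
    rw [Finset.sum_insert ha, Finset.prod_insert ha, laurentMonomial_add (hγ a), ih]
    intro k hk
    rw [Finset.sum_apply]
    exact Finset.sum_nonneg fun i _ => hγ i k hk

theorem laurentMonomial_nsmul {n : ℕ} (m : ℕ) (γ : Fin n → ℤ) (z : Fin n → ℂ) :
    laurentMonomial (m • γ) z = laurentMonomial γ z ^ m := by
  simp only [laurentMonomial, ← Finset.prod_pow, Pi.smul_apply, nsmul_eq_mul]
  refine Finset.prod_congr rfl fun k _ => ?_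
  rw [mul_comm, zpow_mul, zpow_natCast]

/-- Clearing denominators does not change the polyhedron. -/
theorem exists_integralPolyhedron_eq {n : ℕ} (b : Matrix (Fin n) (Fin n) ℚ) :
    ∃ G, monomialSublevelSet b = integralPolyhedron G := by
  have hD : ∃ D : ℕ, 0 < D ∧ ∀ j k, ∃ m : ℤ, (m : ℚ) = b j k * D := by
    refine ⟨∏ p : Fin n × Fin n, (b p.1 p.2).den, Finset.prod_pos fun p _ => (b p.1 p.2).den_pos,
      fun j k => ?_⟩
    obtain ⟨c, hc⟩ := Finset.dvd_prod_of_mem (fun p : Fin n × Fin n => (b p.1 p.2).den)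
      (Finset.mem_univ (j, k))
    refine ⟨(b j k).num * c, ?_⟩
    rw [hc]
    push_cast
    rw [← mul_assoc, Rat.mul_den_eq_num]
  obtain ⟨D, hD0, hD⟩ := hD
  choose G hG using hD
  refine ⟨Matrix.of G, ?_⟩
  have hD' : (0 : ℚ) < D := by exact_mod_cast hD0
  ext z
  refine forall_congr' fun j => and_congr (forall_congr' fun k => ?_) ?_
  · have : G j k < 0 ↔ b j k < 0 := by
      rw [← Int.cast_lt (R := ℚ), hG, Int.cast_zero]
      constructor
      · intro h; by_contra! h'; nlinarith [mul_nonneg h' hD'.le]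
      · intro h; exact mul_neg_of_neg_of_pos h hD'
    rw [Matrix.of_apply, this]
  · have : ‖laurentMonomial (Matrix.of G j) z‖ = (∏ k, ‖z k‖ ^ ((b j k : ℚ) : ℝ)) ^ D := by
      rw [norm_laurentMonomial, ← Finset.prod_pow]
      refine Finset.prod_congr rfl fun k _ => ?_
      rw [← Real.rpow_natCast, ← Real.rpow_mul (norm_nonneg _), ← Real.rpow_intCast]
      congr 1
      have := hG j k
      rw [Matrix.of_apply]
      exact_mod_cast this
    rw [this, pow_lt_one_iff_of_nonneg
      (Finset.prod_nonneg fun k _ => Real.rpow_nonneg (norm_nonneg _) _) hD0.ne']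

theorem mul_conj_mem_integralPolyhedron {n : ℕ} {G : Matrix (Fin n) (Fin n) ℤ}
    {z w : Fin n → ℂ} (hz : z ∈ integralPolyhedron G) (hw : w ∈ integralPolyhedron G) :
    (z * fun k => conj (w k)) ∈ integralPolyhedron G := by
  refine fun j => ⟨fun k hk => ?_, ?_⟩
  · simpa using ⟨(hz j).1 k hk, (hw j).1 k hk⟩
  · rw [laurentMonomial_mul, norm_mul, laurentMonomial_conj, RCLike.norm_conj]
    exact mul_lt_one_of_nonneg_of_lt_one_left (norm_nonneg _) (hz j).2 (hw j).2.le

/-! ### Integer points of a simplicial cone -/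

/-- The coordinates `β G⁻¹` of the integer vector `β` with respect to the rows of `G`. They are
meaningful when `det G ≠ 0`. -/
noncomputable def coneCoord {n : ℕ} (G : Matrix (Fin n) (Fin n) ℤ) (β : Fin n → ℤ) :
    Fin n → ℝ :=
  Matrix.vecMul (fun k => (β k : ℝ)) (G.map (Int.cast : ℤ → ℝ))⁻¹

/-- The exponents `α` for which `α + 1` lies in the open cone spanned by the rows of `G`. These are
the exponents of the square integrable Laurent monomials on `integralPolyhedron G`; the shift by
`1` comes from the area form `r dr dθ`. -/
def coneExponents {n : ℕ} (G : Matrix (Fin n) (Fin n) ℤ) : Set (Fin n → ℤ) :=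
  {α | ∀ j, 0 < coneCoord G (α + 1) j}

/-- The exponents `α` for which `α + 1` lies in the half-open parallelepiped spanned by the rows of
`G`: representatives of `coneExponents G` modulo translation by the rows. -/
def fundamentalBox {n : ℕ} (G : Matrix (Fin n) (Fin n) ℤ) : Set (Fin n → ℤ) :=
  {α | ∀ j, 0 < coneCoord G (α + 1) j ∧ coneCoord G (α + 1) j ≤ 1}

section Cone

variable {n : ℕ} {G : Matrix (Fin n) (Fin n) ℤ}

theorem det_map_intCast_ne_zero (hG : G.det ≠ 0) : (G.map (Int.cast : ℤ → ℝ)).det ≠ 0 := by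
  have : (G.map (Int.cast : ℤ → ℝ)).det = (G.det : ℝ) := by
    rw [Int.cast_det]
  rw [this]
  exact_mod_cast hG

theorem vecMul_coneCoord (hG : G.det ≠ 0) (β : Fin n → ℤ) :
    Matrix.vecMul (coneCoord G β) (G.map (Int.cast : ℤ → ℝ)) = fun k => (β k : ℝ) := by
  rw [coneCoord, Matrix.vecMul_vecMul,
    Matrix.nonsing_inv_mul _ (det_map_intCast_ne_zero hG).isUnit, Matrix.vecMul_one]

theorem coneCoord_add (β γ : Fin n → ℤ) :
    coneCoord G (β + γ) = coneCoord G β + coneCoord G γ := by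
  rw [coneCoord, coneCoord, coneCoord, ← Matrix.add_vecMul]
  congr 1
  ext k; simp

theorem coneCoord_vecMul (hG : G.det ≠ 0) (m : Fin n → ℤ) :
    coneCoord G (Matrix.vecMul m G) = fun j => (m j : ℝ) := by
  have : (fun k => ((Matrix.vecMul m G k : ℤ) : ℝ)) =
      Matrix.vecMul (fun j => (m j : ℝ)) (G.map (Int.cast : ℤ → ℝ)) := by
    ext k; simp [Matrix.vecMul, dotProduct]
  rw [coneCoord, this, Matrix.vecMul_vecMul,
    Matrix.mul_nonsing_inv _ (det_map_intCast_ne_zero hG).isUnit, Matrix.vecMul_one]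

theorem fundamentalBox_subset : fundamentalBox G ⊆ coneExponents G := fun _ h j => (h j).1

/-- If the `k`-th coordinate may vanish on the polyhedron, then the `k`-th column of `G` is
nonnegative and nonzero, so `α k + 1 > 0` for each `α` in the cone. Hence square integrable
monomials have no poles on the polyhedron. -/
theorem nonneg_of_mem_coneExponents (hG : G.det ≠ 0) {α : Fin n → ℤ} (hα : α ∈ coneExponents G)
    {z : Fin n → ℂ} (hz : z ∈ integralPolyhedron G) {k : Fin n} (hk : z k = 0) : 0 ≤ α k := by
  have hnn : ∀ j, 0 ≤ G j k := fun j => by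
    by_contra! h
    exact (hz j).1 k h hk
  obtain ⟨j₀, hj₀⟩ : ∃ j, G j k ≠ 0 := by
    by_contra! h
    exact hG (Matrix.det_eq_zero_of_column_eq_zero k h)
  have h1 := congrFun (vecMul_coneCoord hG (α + 1)) k
  have h2 : 0 < Matrix.vecMul (coneCoord G (α + 1)) (G.map (Int.cast : ℤ → ℝ)) k := by
    simp only [Matrix.vecMul, dotProduct, Matrix.map_apply]
    refine Finset.sum_pos' (fun j _ => mul_nonneg (hα j).le (by exact_mod_cast hnn j))
      ⟨j₀, Finset.mem_univ _, mul_pos (hα j₀) ?_⟩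
    exact_mod_cast lt_of_le_of_ne (hnn j₀) hj₀.symm
  rw [h1] at h2
  have h3 : 0 < (α + 1) k := by exact_mod_cast h2
  simp only [Pi.add_apply, Pi.one_apply] at h3
  omega

theorem row_nonneg {z : Fin n → ℂ} (hz : z ∈ integralPolyhedron G) (j k : Fin n)
    (hk : z k = 0) : 0 ≤ G j k := by
  by_contra! h
  exact (hz j).1 k h hk

theorem finite_fundamentalBox (hG : G.det ≠ 0) : (fundamentalBox G).Finite := by
  refine ((Set.finite_Icc (fun k => -∑ j, |G j k| - 1 : Fin n → ℤ)
    (fun k => ∑ j, |G j k|)).subset ?_)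
  intro α hα
  have key : ∀ k, |(((α k + 1 : ℤ)) : ℝ)| ≤ ((∑ j, |G j k| : ℤ) : ℝ) := by
    intro k
    have h1 := congrFun (vecMul_coneCoord hG (α + 1)) k
    simp only [Pi.add_apply, Pi.one_apply] at h1
    rw [← h1]
    simp only [Matrix.vecMul, dotProduct, Matrix.map_apply]
    push_cast
    refine (Finset.abs_sum_le_sum_abs _ _).trans (Finset.sum_le_sum fun j _ => ?_)
    rw [abs_mul, abs_of_pos (hα j).1]
    exact mul_le_of_le_one_left (abs_nonneg _) (hα j).2
  constructor <;> intro k <;> have := key k <;> rw [← Int.cast_abs, Int.cast_le, abs_le] at this <;>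
    simp only <;> omega

/-- Every exponent in the cone is uniquely an element of the box plus a combination of the rows with
natural number coefficients, namely `⌈s⌉ - 1` for a coordinate `s`. -/
noncomputable def coneExponentsEquiv (hG : G.det ≠ 0) :
    fundamentalBox G × (Fin n → ℕ) ≃ coneExponents G where
  toFun p := ⟨p.1.1 + Matrix.vecMul (fun j => (p.2 j : ℤ)) G, fun j => by
    rw [add_right_comm, coneCoord_add, coneCoord_vecMul hG]
    have := (p.1.2 j).1
    simp only [Pi.add_apply, Int.cast_natCast]
    positivity⟩
  invFun α := (⟨α.1 - Matrix.vecMul (fun j => ⌈coneCoord G (α.1 + 1) j⌉ - 1) G, fun j => by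
      have h : α.1 + 1 = (α.1 - Matrix.vecMul (fun j => ⌈coneCoord G (α.1 + 1) j⌉ - 1) G + 1) +
          Matrix.vecMul (fun j => ⌈coneCoord G (α.1 + 1) j⌉ - 1) G := by abel
      have h2 := congrFun (coneCoord_add (G := G)
        (α.1 - Matrix.vecMul (fun j => ⌈coneCoord G (α.1 + 1) j⌉ - 1) G + 1)
        (Matrix.vecMul (fun j => ⌈coneCoord G (α.1 + 1) j⌉ - 1) G)) j
      rw [← h, coneCoord_vecMul hG, Pi.add_apply] at h2
      push_cast at h2
      have := Int.ceil_lt_add_one (coneCoord G (α.1 + 1) j)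
      have := Int.le_ceil (coneCoord G (α.1 + 1) j)
      constructor <;> linarith⟩, fun j => (⌈coneCoord G (α.1 + 1) j⌉ - 1).toNat)
  left_inv p := by
    have h : ∀ j, ⌈coneCoord G (p.1.1 + Matrix.vecMul (fun j => (p.2 j : ℤ)) G + 1) j⌉ - 1 =
        (p.2 j : ℤ) := by
      intro j
      rw [add_right_comm, coneCoord_add, coneCoord_vecMul hG]
      have h1 := (p.1.2 j).1
      have h2 := (p.1.2 j).2
      rw [sub_eq_iff_eq_add, Int.ceil_eq_iff]
      simp only [Pi.add_apply]
      push_cast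
      constructor <;> linarith
    ext : 1
    · ext : 1
      simp only [h]
      abel
    · funext j
      simp only [h]
      simp
  right_inv α := by
    have h : ∀ j, (((⌈coneCoord G (α.1 + 1) j⌉ - 1).toNat : ℕ) : ℤ) =
        ⌈coneCoord G (α.1 + 1) j⌉ - 1 := by
      intro j
      refine Int.toNat_of_nonneg ?_
      have := Int.ceil_pos.2 (α.2 j)
      omega
    ext : 1
    simp only [h]
    abel

end Cone

/-! ### The generating function of the cone -/

theorem hasSum_mul_of_hasSum {ι κ : Type*} {f : ι → ℂ} {g : κ → ℂ} {a b : ℂ} (hf : HasSum f a)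
    (hg : HasSum g b) : HasSum (fun p : ι × κ => f p.1 * g p.2) (a * b) := by
  have h1 : Summable fun m => ‖f m‖ := hf.summable.norm
  have h2 : Summable fun m => ‖g m‖ := hg.summable.norm
  exact hf.mul hg (summable_mul_of_summable_norm h1 h2)

theorem hasSum_pi_prod {n : ℕ} {f : Fin n → ℕ → ℂ} {a : Fin n → ℂ}
    (hf : ∀ j, HasSum (f j) (a j)) :
    HasSum (fun m : Fin n → ℕ => ∏ j, f j (m j)) (∏ j, a j) := by
  induction n with
  | zero =>
    simp only [Finset.univ_eq_empty, Finset.prod_empty]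
    exact hasSum_unique (fun _ : Fin 0 → ℕ => (1 : ℂ))
  | succ n ih =>
    rw [← (Fin.consEquiv fun _ : Fin (n + 1) => ℕ).hasSum_iff, Fin.prod_univ_succ]
    have ih' : HasSum (fun m : Fin n → ℕ => ∏ j : Fin n, f j.succ (m j))
        (∏ j : Fin n, a j.succ) := ih (f := fun j => f j.succ) (fun j => hf j.succ)
    have e : (fun m : Fin (n + 1) → ℕ => ∏ j, f j (m j)) ∘ (Fin.consEquiv fun _ => ℕ) =
        fun p : ℕ × (Fin n → ℕ) => f 0 p.1 * ∏ j : Fin n, f j.succ (p.2 j) := by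
      funext p
      rw [Function.comp_apply, Fin.prod_univ_succ]
      simp only [Fin.consEquiv, Equiv.coe_fn_mk, Fin.cons_zero, Fin.cons_succ]
    rw [e]
    exact hasSum_mul_of_hasSum (g := fun m : Fin n → ℕ => ∏ j : Fin n, f j.succ (m j)) (hf 0) ih'

theorem hasSum_add_natCast_mul_pow (s : ℂ) {u : ℂ} (hu : ‖u‖ < 1) :
    HasSum (fun m : ℕ => (s + m) * u ^ m) ((s + (1 - s) * u) / (1 - u) ^ 2) := by
  have h0 : (1 - u) ≠ 0 := by
    intro h
    rw [← sub_eq_zero.1 h] at hu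
    simp at hu
  have := ((hasSum_geometric_of_norm_lt_one hu).mul_left s).add
    (hasSum_coe_mul_geometric_of_norm_lt_one hu)
  have h1 : (fun m : ℕ => (s + m) * u ^ m) = fun m : ℕ => s * u ^ m + m * u ^ m := by
    funext m
    exact add_mul _ _ _
  have h2 : (s + (1 - s) * u) / (1 - u) ^ 2 = s * (1 - u)⁻¹ + u / (1 - u) ^ 2 := by
    field_simp
    ring
  rw [h1, h2]
  exact this

/-- The closed form of `∑ (∏ j, s_j(α + 1)) * t ^ α` over `α ∈ coneExponents G`, where `s` is
`coneCoord G`. The sum over the box is finite when `det G ≠ 0`. -/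
noncomputable def coneSum {n : ℕ} (G : Matrix (Fin n) (Fin n) ℤ) (t : Fin n → ℂ) : ℂ :=
  ∑' μ : fundamentalBox G, laurentMonomial μ.1 t *
    ∏ j, ((coneCoord G (μ.1 + 1) j : ℂ) + (1 - (coneCoord G (μ.1 + 1) j : ℂ)) *
      laurentMonomial (G j) t) / (1 - laurentMonomial (G j) t) ^ 2

theorem hasSum_coneSum {n : ℕ} {G : Matrix (Fin n) (Fin n) ℤ} (hG : G.det ≠ 0) {t : Fin n → ℂ}
    (ht : t ∈ integralPolyhedron G) :
    HasSum (fun α : coneExponents G =>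
      (∏ j, (coneCoord G (α.1 + 1) j : ℂ)) * laurentMonomial α.1 t) (coneSum G t) := by
  have hfin : Finite (fundamentalBox G) := finite_fundamentalBox hG
  rw [← (coneExponentsEquiv hG).hasSum_iff]
  -- Substitute `α = μ + ∑ m_j (G j)`; the monomial then factors, as no exponent is negative at a
  -- vanishing coordinate.
  have hterm : ((fun α : coneExponents G => (∏ j, (coneCoord G (α.1 + 1) j : ℂ)) *
        laurentMonomial α.1 t) ∘ coneExponentsEquiv hG) =
      fun p : fundamentalBox G × (Fin n → ℕ) => laurentMonomial p.1.1 t *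
        ∏ j, ((coneCoord G (p.1.1 + 1) j : ℂ) + p.2 j) * laurentMonomial (G j) t ^ p.2 j := by
    ext p
    have h1 : coneCoord G (p.1.1 + Matrix.vecMul (fun j => (p.2 j : ℤ)) G + 1) =
        fun j => coneCoord G (p.1.1 + 1) j + p.2 j := by
      rw [add_right_comm, coneCoord_add, coneCoord_vecMul hG]
      ext j; simp
    have h2 : Matrix.vecMul (fun j => (p.2 j : ℤ)) G = ∑ j, p.2 j • G j := by
      ext k; simp [Matrix.vecMul, dotProduct]
    have h3 : ∀ j k, t k = 0 → 0 ≤ (p.2 j • G j) k := fun j k hk => by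
      simpa using mul_nonneg (Int.natCast_nonneg _) (row_nonneg ht j k hk)
    have h4 : laurentMonomial (p.1.1 + Matrix.vecMul (fun j => (p.2 j : ℤ)) G) t =
        laurentMonomial p.1.1 t * ∏ j, laurentMonomial (G j) t ^ p.2 j := by
      rw [laurentMonomial_add, h2, laurentMonomial_sum _ h3]
      · simp_rw [laurentMonomial_nsmul]
      · exact fun k hk => nonneg_of_mem_coneExponents hG (fundamentalBox_subset p.1.2) ht hk
      · intro k hk
        rw [h2, Finset.sum_apply]
        exact Finset.sum_nonneg fun j _ => h3 j k hk
    simp only [Function.comp_apply, coneExponentsEquiv, Equiv.coe_fn_mk, h1, h4,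
      Finset.prod_mul_distrib]
    push_cast
    ring
  rw [hterm]
  have hfib : ∀ μ : fundamentalBox G, HasSum (fun m : Fin n → ℕ => laurentMonomial μ.1 t *
        ∏ j, ((coneCoord G (μ.1 + 1) j : ℂ) + m j) * laurentMonomial (G j) t ^ m j)
      (laurentMonomial μ.1 t * ∏ j, ((coneCoord G (μ.1 + 1) j : ℂ) +
        (1 - (coneCoord G (μ.1 + 1) j : ℂ)) * laurentMonomial (G j) t) /
        (1 - laurentMonomial (G j) t) ^ 2) := fun μ =>
    (hasSum_pi_prod fun j => hasSum_add_natCast_mul_pow _ (ht j).2).mul_left _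
  have hsum : Summable fun p : fundamentalBox G × (Fin n → ℕ) => laurentMonomial p.1.1 t *
      ∏ j, ((coneCoord G (p.1.1 + 1) j : ℂ) + p.2 j) * laurentMonomial (G j) t ^ p.2 j := by
    refine Summable.of_norm ((summable_prod_of_nonneg fun _ => norm_nonneg _).2
      ⟨fun μ => (hfib μ).summable.norm, Summable.of_finite⟩)
  have h := hsum.hasSum.prod_fiberwise hfib
  rw [coneSum, h.tsum_eq]
  exact hsum.hasSum

/-! ### Rational functions in the first variable and the conjugate of the second -/

namespace IsSesquiRationalOn

variable {n : ℕ} {Ω : Set (Fin n → ℂ)} {F F' : (Fin n → ℂ) → (Fin n → ℂ) → ℂ}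

theorem congr (h : IsSesquiRationalOn Ω F) (e : ∀ z ∈ Ω, ∀ w ∈ Ω, F' z w = F z w) :
    IsSesquiRationalOn Ω F' := by
  obtain ⟨P, Q, hPQ⟩ := h
  exact ⟨P, Q, fun z hz w hw => ⟨(hPQ z hz w hw).1, (e z hz w hw).trans (hPQ z hz w hw).2⟩⟩

theorem of_eval (P : MvPolynomial (Fin n ⊕ Fin n) ℂ) :
    IsSesquiRationalOn Ω fun z w => MvPolynomial.eval (pairConj z w) P :=
  ⟨P, 1, fun z _ w _ => by simp⟩

theorem const (c : ℂ) : IsSesquiRationalOn Ω fun _ _ => c :=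
  (of_eval (MvPolynomial.C c)).congr fun z _ w _ => by simp

theorem add (h : IsSesquiRationalOn Ω F) (h' : IsSesquiRationalOn Ω F') :
    IsSesquiRationalOn Ω fun z w => F z w + F' z w := by
  obtain ⟨P, Q, hPQ⟩ := h
  obtain ⟨P', Q', hPQ'⟩ := h'
  refine ⟨P * Q' + Q * P', Q * Q', fun z hz w hw => ?_⟩
  obtain ⟨h1, h2⟩ := hPQ z hz w hw
  obtain ⟨h3, h4⟩ := hPQ' z hz w hw
  simp only [map_mul, map_add]
  exact ⟨mul_ne_zero h1 h3, by rw [h2, h4, div_add_div _ _ h1 h3]⟩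

theorem mul (h : IsSesquiRationalOn Ω F) (h' : IsSesquiRationalOn Ω F') :
    IsSesquiRationalOn Ω fun z w => F z w * F' z w := by
  obtain ⟨P, Q, hPQ⟩ := h
  obtain ⟨P', Q', hPQ'⟩ := h'
  refine ⟨P * P', Q * Q', fun z hz w hw => ?_⟩
  obtain ⟨h1, h2⟩ := hPQ z hz w hw
  obtain ⟨h3, h4⟩ := hPQ' z hz w hw
  simp only [map_mul]
  exact ⟨mul_ne_zero h1 h3, by rw [h2, h4, div_mul_div_comm]⟩

theorem inv (h : IsSesquiRationalOn Ω F) (h0 : ∀ z ∈ Ω, ∀ w ∈ Ω, F z w ≠ 0) :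
    IsSesquiRationalOn Ω fun z w => (F z w)⁻¹ := by
  obtain ⟨P, Q, hPQ⟩ := h
  refine ⟨Q, P, fun z hz w hw => ?_⟩
  obtain ⟨h1, h2⟩ := hPQ z hz w hw
  refine ⟨fun h3 => h0 z hz w hw ?_, by simp only [h2, inv_div]⟩
  rw [h2, h3, zero_div]

theorem sum {ι : Type*} (s : Finset ι) {F : ι → (Fin n → ℂ) → (Fin n → ℂ) → ℂ}
    (h : ∀ i ∈ s, IsSesquiRationalOn Ω (F i)) :
    IsSesquiRationalOn Ω fun z w => ∑ i ∈ s, F i z w := by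
  classical
  induction s using Finset.induction_on with
  | empty => simpa using const 0
  | insert a s ha ih =>
    simp only [Finset.sum_insert ha]
    exact (h a (Finset.mem_insert_self _ _)).add
      (ih fun i hi => h i (Finset.mem_insert_of_mem hi))

theorem prod {ι : Type*} (s : Finset ι) {F : ι → (Fin n → ℂ) → (Fin n → ℂ) → ℂ}
    (h : ∀ i ∈ s, IsSesquiRationalOn Ω (F i)) :
    IsSesquiRationalOn Ω fun z w => ∏ i ∈ s, F i z w := by
  classical
  induction s using Finset.induction_on with
  | empty => simpa using const 1
  | insert a s ha ih =>
    simp only [Finset.prod_insert ha]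
    exact (h a (Finset.mem_insert_self _ _)).mul
      (ih fun i hi => h i (Finset.mem_insert_of_mem hi))

theorem pow (h : IsSesquiRationalOn Ω F) (m : ℕ) : IsSesquiRationalOn Ω fun z w => F z w ^ m := by
  simpa using prod (Finset.range m) (F := fun _ => F) fun _ _ => h

theorem laurentMonomial_mul_conj {γ : Fin n → ℤ} (hγ : ∀ z ∈ Ω, ∀ k, z k = 0 → 0 ≤ γ k) :
    IsSesquiRationalOn Ω fun z w => laurentMonomial γ (z * fun k => conj (w k)) := by
  refine prod _ fun k _ => ?_
  have hk : IsSesquiRationalOn Ω fun z w : Fin n → ℂ => z k * conj (w k) :=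
    (of_eval (MvPolynomial.X (Sum.inl k) * MvPolynomial.X (Sum.inr k))).congr
      fun z _ w _ => by simp [pairConj]
  rcases le_or_gt 0 (γ k) with h | h
  · obtain ⟨m, hm⟩ := Int.eq_ofNat_of_zero_le h
    refine (hk.pow m).congr fun z _ w _ => ?_
    rw [hm]
    simp
  · obtain ⟨m, hm⟩ := Int.eq_ofNat_of_zero_le (neg_nonneg.2 h.le)
    have h0 : ∀ z ∈ Ω, z k ≠ 0 := fun z hz h' => (hγ z hz k h').not_gt h
    refine ((hk.pow m).inv fun z hz w hw => pow_ne_zero _ (mul_ne_zero (h0 z hz) ?_)).congr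
      fun z _ w _ => ?_
    · simpa using h0 w hw
    · rw [← neg_neg (γ k), hm, zpow_neg, zpow_natCast]
      rfl

/-- A rational function without poles is holomorphic in its first variable. -/
theorem differentiableOn (h : IsSesquiRationalOn Ω F) {w : Fin n → ℂ} (hw : w ∈ Ω) :
    DifferentiableOn ℂ (fun z => F z w) Ω := by
  obtain ⟨P, Q, hPQ⟩ := h
  have hd : ∀ R : MvPolynomial (Fin n ⊕ Fin n) ℂ,
      Differentiable ℂ fun z : Fin n → ℂ => MvPolynomial.eval (pairConj z w) R := by
    intro R
    induction R using MvPolynomial.induction_on with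
    | C a => simp
    | add p q hp hq => simp only [map_add]; exact hp.add hq
    | mul_X p i hp =>
      have : Differentiable ℂ fun z : Fin n → ℂ => pairConj z w i := by
        cases i with
        | inl k => simpa [pairConj] using differentiable_pi.1 differentiable_id k
        | inr k => simp [pairConj]
      simp only [map_mul, MvPolynomial.eval_X]
      exact hp.mul this
  refine ((hd P).differentiableOn.mul ((hd Q).differentiableOn.inv fun z hz =>
    (hPQ z hz w hw).1)).congr fun z hz => ?_
  exact (hPQ z hz w hw).2.trans (div_eq_mul_inv _ _)

end IsSesquiRationalOn

theorem isSesquiRationalOn_coneSum {n : ℕ} {G : Matrix (Fin n) (Fin n) ℤ} (hG : G.det ≠ 0) :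
    IsSesquiRationalOn (integralPolyhedron G) fun z w => coneSum G (z * fun k => conj (w k)) := by
  have hfin : Finite (fundamentalBox G) := finite_fundamentalBox hG
  have := Fintype.ofFinite (fundamentalBox G)
  simp only [coneSum, tsum_fintype]
  have hu : ∀ j, IsSesquiRationalOn (integralPolyhedron G) fun z w =>
      laurentMonomial (G j) (z * fun k => conj (w k)) := fun j =>
    .laurentMonomial_mul_conj fun z hz k hk => row_nonneg hz j k hk
  refine .sum _ fun μ _ => .mul (.laurentMonomial_mul_conj fun z hz k hk =>
    nonneg_of_mem_coneExponents hG (fundamentalBox_subset μ.2) hz hk) (.prod _ fun j _ => ?_)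
  have hden : IsSesquiRationalOn (integralPolyhedron G) fun z w =>
      (1 - laurentMonomial (G j) (z * fun k => conj (w k))) ^ 2 :=
    (((IsSesquiRationalOn.const 1).add ((IsSesquiRationalOn.const (-1)).mul (hu j))).pow 2).congr
      fun z _ w _ => by ring
  refine (((IsSesquiRationalOn.const _).add ((IsSesquiRationalOn.const _).mul (hu j))).mul
    (hden.inv fun z hz w hw => ?_)).congr fun z _ w _ => div_eq_mul_inv _ _
  refine pow_ne_zero _ fun h => ?_
  have := (mul_conj_mem_integralPolyhedron hz hw j).2
  rw [← sub_eq_zero.1 h] at this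
  simp at this

/-! ### The torus action and torus averages of holomorphic functions -/

/-- The Haar probability measure on `(ℝ / ℤ)ⁿ`, with respect to which Mathlib's
`UnitAddTorus.mFourierCoeff` is defined. -/
noncomputable def torusMeasure (n : ℕ) : Measure (UnitAddTorus (Fin n)) :=
  Measure.pi fun _ => AddCircle.haarAddCircle

instance (n : ℕ) : IsProbabilityMeasure (torusMeasure n) := by
  unfold torusMeasure; infer_instance

instance (n : ℕ) : (torusMeasure n).IsAddHaarMeasure := by
  unfold torusMeasure; infer_instance

/-- The action of the torus on `ℂⁿ` by coordinatewise rotation. -/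
noncomputable def torusRotate {n : ℕ} (t : UnitAddTorus (Fin n)) (z : Fin n → ℂ) : Fin n → ℂ :=
  fun k => ((t k).toCircle : ℂ) * z k

section Torus

variable {n : ℕ}

theorem torusRotate_zero (z : Fin n → ℂ) : torusRotate 0 z = z := by
  ext k; simp [torusRotate]

theorem torusRotate_add (s t : UnitAddTorus (Fin n)) (z : Fin n → ℂ) :
    torusRotate (s + t) z = torusRotate s (torusRotate t z) := by
  ext k; simp [torusRotate, AddCircle.toCircle_add, mul_assoc]

theorem continuous_torusRotate :
    Continuous fun p : UnitAddTorus (Fin n) × (Fin n → ℂ) => torusRotate p.1 p.2 := by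
  refine continuous_pi fun k => ?_
  have : Continuous fun p : UnitAddTorus (Fin n) × (Fin n → ℂ) =>
      (AddCircle.toCircle (p.1 k) : ℂ) :=
    continuous_subtype_val.comp (AddCircle.continuous_toCircle.comp
      ((continuous_apply k).comp continuous_fst))
  exact this.mul ((continuous_apply k).comp continuous_snd)

theorem norm_torusRotate (t : UnitAddTorus (Fin n)) (z : Fin n → ℂ) (k : Fin n) :
    ‖torusRotate t z k‖ = ‖z k‖ := by
  rw [torusRotate, norm_mul, Circle.norm_coe, one_mul]

theorem torusRotate_eq_zero_iff (t : UnitAddTorus (Fin n)) (z : Fin n → ℂ) (k : Fin n) :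
    torusRotate t z k = 0 ↔ z k = 0 := by
  rw [← norm_eq_zero, norm_torusRotate, norm_eq_zero]

theorem laurentMonomial_torusRotate (α : Fin n → ℤ) (t : UnitAddTorus (Fin n)) (z : Fin n → ℂ) :
    laurentMonomial α (torusRotate t z) = UnitAddTorus.mFourier α t * laurentMonomial α z := by
  simp only [laurentMonomial, torusRotate, mul_zpow, Finset.prod_mul_distrib]
  congr 1
  simp only [UnitAddTorus.mFourier, ContinuousMap.coe_mk]
  refine Finset.prod_congr rfl fun k _ => ?_
  rw [fourier_apply, AddCircle.toCircle_zsmul, Circle.coe_zpow]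

theorem torusRotate_mem_integralPolyhedron {G : Matrix (Fin n) (Fin n) ℤ}
    (t : UnitAddTorus (Fin n)) {z : Fin n → ℂ} :
    torusRotate t z ∈ integralPolyhedron G ↔ z ∈ integralPolyhedron G := by
  simp only [integralPolyhedron, mem_ofPred_eq, norm_laurentMonomial, norm_torusRotate, ne_eq,
    torusRotate_eq_zero_iff]

theorem measurePreserving_torusRotate (t : UnitAddTorus (Fin n)) :
    MeasurePreserving (torusRotate t) (volume : Measure (Fin n → ℂ)) volume :=
  volume_preserving_pi fun k => (rotation (t k).toCircle).measurePreserving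

/-- The mean of `g` over the torus orbit of `z`. -/
noncomputable def torusAverage (g : (Fin n → ℂ) → ℂ) (z : Fin n → ℂ) : ℂ :=
  ∫ t, g (torusRotate t z) ∂torusMeasure n

theorem torusAverage_torusRotate (g : (Fin n → ℂ) → ℂ) (s : UnitAddTorus (Fin n))
    (z : Fin n → ℂ) : torusAverage g (torusRotate s z) = torusAverage g z := by
  simp only [torusAverage, ← torusRotate_add]
  exact integral_add_right_eq_self (fun t => g (torusRotate t z)) s

theorem continuousOn_comp_torusRotate {X : Type*} [TopologicalSpace X] {g : (Fin n → ℂ) → ℂ}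
    {Ω : Set (Fin n → ℂ)} (hg : ContinuousOn g Ω) (hΩ : ∀ t, ∀ z ∈ Ω, torusRotate t z ∈ Ω)
    {S : Set X} {φ : X → Fin n → ℂ} (hφ : ContinuousOn φ S) (hφΩ : MapsTo φ S Ω) :
    ContinuousOn (fun p : X × UnitAddTorus (Fin n) => g (torusRotate p.2 (φ p.1)))
      (S ×ˢ univ) := by
  refine hg.comp (continuous_torusRotate.comp_continuousOn
    (continuousOn_snd.prodMk (hφ.comp continuousOn_fst fun p hp => hp.1)))
    fun p hp => hΩ _ _ (hφΩ hp.1)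

theorem integral_intervalIntegral_torusRotate {g : (Fin n → ℂ) → ℂ}
    {Ω : Set (Fin n → ℂ)} (hg : ContinuousOn g Ω) (hΩ : ∀ t, ∀ z ∈ Ω, torusRotate t z ∈ Ω)
    {φ : ℝ → Fin n → ℂ} (hφ : Continuous φ) (hφΩ : ∀ x ∈ Icc (0 : ℝ) 1, φ x ∈ Ω) :
    Integrable (fun t => ∫ x in (0 : ℝ)..1, g (torusRotate t (φ x))) (torusMeasure n) ∧
    ∫ t, (∫ x in (0 : ℝ)..1, g (torusRotate t (φ x))) ∂torusMeasure n =
      ∫ x in (0 : ℝ)..1, torusAverage g (φ x) := by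
  have hint : Integrable (Function.uncurry fun x t => g (torusRotate t (φ x)))
      ((volume.restrict (uIoc (0 : ℝ) 1)).prod (torusMeasure n)) := by
    have h1 : IntegrableOn (fun p : ℝ × UnitAddTorus (Fin n) => g (torusRotate p.2 (φ p.1)))
        (Icc (0 : ℝ) 1 ×ˢ univ) (volume.prod (torusMeasure n)) :=
      (continuousOn_comp_torusRotate hg hΩ hφ.continuousOn hφΩ).integrableOn_compact
        (isCompact_Icc.prod isCompact_univ)
    have h2 := h1.mono_set (prod_mono_left (t := univ)
      ((uIoc_of_le (zero_le_one' ℝ)).trans_subset Ioc_subset_Icc_self))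
    rw [IntegrableOn, ← Measure.prod_restrict, Measure.restrict_univ] at h2
    exact h2
  refine ⟨?_, (intervalIntegral_integral_swap hint).symm⟩
  have := hint.integral_prod_right
  simpa only [intervalIntegral.intervalIntegral_eq_integral_uIoc, zero_le_one, if_true,
    one_smul, Function.uncurry_apply_pair] using this

/-- The holomorphic curve `s ↦ exp (ξ + s v)` (coordinatewise) in `(ℂ \ {0})ⁿ`. It moves the
logarithms of the absolute values along a segment when `s` is real, and rotates the coordinates when
`s` is imaginary. -/
noncomputable def expCurve (ξ v : Fin n → ℝ) (s : ℂ) : Fin n → ℂ :=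
  fun k => Complex.exp (ξ k + s * v k)

theorem differentiable_expCurve (ξ v : Fin n → ℝ) : Differentiable ℂ (expCurve ξ v) := by
  unfold expCurve
  fun_prop

theorem expCurve_add_mul_I (ξ v : Fin n → ℝ) (x y : ℝ) :
    expCurve ξ v (x + y * Complex.I) =
      torusRotate (fun k => ((y * v k / (2 * Real.pi) : ℝ) : UnitAddCircle))
        (expCurve ξ v x) := by
  ext k
  simp only [expCurve, torusRotate, AddCircle.toCircle_apply_mk, Circle.coe_exp,
    ← Complex.exp_add]
  congr 1
  push_cast
  have : (Real.pi : ℂ) ≠ 0 := by exact_mod_cast Real.pi_ne_zero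
  field_simp
  ring

/-- The torus average of a holomorphic function does not change along `expCurve`: integrate over the
boundary of the unit square and average over the torus. The averages depend only on the real part of
`s`, so the horizontal sides cancel and the vertical sides give the two values. -/
theorem torusAverage_expCurve {g : (Fin n → ℂ) → ℂ}
    {Ω : Set (Fin n → ℂ)} (hg : DifferentiableOn ℂ g Ω) (hΩo : IsOpen Ω)
    (hΩ : ∀ t, ∀ z ∈ Ω, torusRotate t z ∈ Ω)
    {ξ v : Fin n → ℝ} (hξ : ∀ x ∈ Icc (0 : ℝ) 1, expCurve ξ v x ∈ Ω) :
    torusAverage g (expCurve ξ v 1) = torusAverage g (expCurve ξ v 0) := by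
  have hmem : ∀ s : ℂ, s.re ∈ Icc (0 : ℝ) 1 → expCurve ξ v s ∈ Ω := by
    intro s hs
    rw [← Complex.re_add_im s, expCurve_add_mul_I]
    exact hΩ _ _ (hξ _ hs)
  have havg : ∀ x y : ℝ, torusAverage g (expCurve ξ v (x + y * Complex.I)) =
      torusAverage g (expCurve ξ v x) := by
    intro x y
    rw [expCurve_add_mul_I, torusAverage_torusRotate]
  have hc := (differentiable_expCurve ξ v).continuous
  -- Cauchy–Goursat on the square with corners `0` and `1 + i`, for each rotation separately.
  have hrect : ∀ t : UnitAddTorus (Fin n),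
      (∫ x in (0 : ℝ)..1, g (torusRotate t (expCurve ξ v (x + (0 : ℝ) * Complex.I)))) -
      (∫ x in (0 : ℝ)..1, g (torusRotate t (expCurve ξ v (x + (1 : ℝ) * Complex.I)))) +
      Complex.I * (∫ y in (0 : ℝ)..1, g (torusRotate t (expCurve ξ v ((1 : ℝ) + y * Complex.I)))) -
      Complex.I * (∫ y in (0 : ℝ)..1, g (torusRotate t (expCurve ξ v ((0 : ℝ) + y * Complex.I))))
        = 0 := by
    intro t
    have hd : DifferentiableOn ℂ (fun s => g (torusRotate t (expCurve ξ v s)))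
        {s | s.re ∈ Icc (0 : ℝ) 1} := by
      have h1 : Differentiable ℂ fun s => torusRotate t (expCurve ξ v s) := by
        unfold torusRotate expCurve
        fun_prop
      exact fun s hs => (((hg _ (hΩ t _ (hmem s hs))).differentiableAt
        (hΩo.mem_nhds (hΩ t _ (hmem s hs)))).comp s (h1 s)).differentiableWithinAt
    have := Complex.integral_boundary_rect_eq_zero_of_differentiableOn
      (fun s => g (torusRotate t (expCurve ξ v s))) 0 (1 + Complex.I)
      (hd.mono fun s hs => by simpa using hs.1)
    simpa using this
  obtain ⟨i1, e1⟩ := integral_intervalIntegral_torusRotate hg.continuousOn hΩ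
    (φ := fun x : ℝ => expCurve ξ v (x + (0 : ℝ) * Complex.I)) (by fun_prop)
    (fun x hx => hmem _ (by simpa using hx))
  obtain ⟨i2, e2⟩ := integral_intervalIntegral_torusRotate hg.continuousOn hΩ
    (φ := fun x : ℝ => expCurve ξ v (x + (1 : ℝ) * Complex.I)) (by fun_prop)
    (fun x hx => hmem _ (by simpa using hx))
  obtain ⟨i3, e3⟩ := integral_intervalIntegral_torusRotate hg.continuousOn hΩ
    (φ := fun y : ℝ => expCurve ξ v ((1 : ℝ) + y * Complex.I)) (by fun_prop)
    (fun x hx => hmem _ (by simp))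
  obtain ⟨i4, e4⟩ := integral_intervalIntegral_torusRotate hg.continuousOn hΩ
    (φ := fun y : ℝ => expCurve ξ v ((0 : ℝ) + y * Complex.I)) (by fun_prop)
    (fun x hx => hmem _ (by simp))
  have hlin : ∀ A B C D : UnitAddTorus (Fin n) → ℂ, Integrable A (torusMeasure n) →
      Integrable B (torusMeasure n) → Integrable C (torusMeasure n) →
      Integrable D (torusMeasure n) →
      ∫ t, (A t - B t + Complex.I * C t - Complex.I * D t) ∂torusMeasure n =
        ∫ t, A t ∂torusMeasure n - ∫ t, B t ∂torusMeasure n +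
          Complex.I * ∫ t, C t ∂torusMeasure n - Complex.I * ∫ t, D t ∂torusMeasure n := by
    intro A B C D hA hB hC hD
    rw [integral_sub (f := fun t => A t - B t + Complex.I * C t)
      ((hA.sub hB).add (hC.const_mul _)) (hD.const_mul _),
      integral_add (f := fun t => A t - B t) (hA.sub hB) (hC.const_mul _),
      integral_sub hA hB, integral_const_mul, integral_const_mul]
  have key := (hlin _ _ _ _ i1 i2 i3 i4).symm.trans
    (integral_congr_ae (Filter.Eventually.of_forall hrect))
  rw [e1, e2, e3, e4] at key
  simp only [havg] at key
  simp only [sub_self, zero_add, integral_zero, intervalIntegral.integral_const, sub_zero,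
    one_smul, Complex.ofReal_one, Complex.ofReal_zero] at key
  exact mul_left_cancel₀ Complex.I_ne_zero (sub_eq_zero.1 key)

theorem norm_laurentMonomial_eq_exp (α : Fin n → ℤ) {z : Fin n → ℂ} (hz : ∀ k, z k ≠ 0) :
    ‖laurentMonomial α z‖ = Real.exp (∑ k, (α k : ℝ) * Real.log ‖z k‖) := by
  rw [norm_laurentMonomial, Real.exp_sum]
  refine Finset.prod_congr rfl fun k _ => ?_
  rw [mul_comm, Real.exp_mul, Real.exp_log (norm_pos_iff.2 (hz k)), Real.rpow_intCast]

theorem mem_integralPolyhedron_iff {G : Matrix (Fin n) (Fin n) ℤ} {z : Fin n → ℂ}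
    (hz : ∀ k, z k ≠ 0) : z ∈ integralPolyhedron G ↔
      ∀ j, (G.map (Int.cast : ℤ → ℝ)).mulVec (fun k => Real.log ‖z k‖) j < 0 := by
  refine forall_congr' fun j => ?_
  rw [norm_laurentMonomial_eq_exp _ hz, Real.exp_lt_one_iff]
  simp only [hz, ne_eq, not_false_eq_true, implies_true, true_and, Matrix.mulVec, dotProduct,
    Matrix.map_apply]

theorem laurentMonomial_ne_zero (α : Fin n → ℤ) {z : Fin n → ℂ} (hz : ∀ k, z k ≠ 0) :
    laurentMonomial α z ≠ 0 :=
  Finset.prod_ne_zero_iff.2 fun k _ => zpow_ne_zero _ (hz k)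

theorem exists_torusRotate_expCurve {z : Fin n → ℂ} (hz : ∀ k, z k ≠ 0) (v : Fin n → ℝ) :
    ∃ t, z = torusRotate t (expCurve (fun k => Real.log ‖z k‖) v 0) := by
  refine ⟨fun k => ((Complex.arg (z k) / (2 * Real.pi) : ℝ) : UnitAddCircle), ?_⟩
  ext k
  simp only [expCurve, torusRotate, AddCircle.toCircle_apply_mk, Circle.coe_exp]
  rw [zero_mul, add_zero, ← Complex.ofReal_exp, Real.exp_log (norm_pos_iff.2 (hz k))]
  have : 2 * Real.pi / 1 * (Complex.arg (z k) / (2 * Real.pi)) = Complex.arg (z k) := by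
    field_simp
  rw [this, mul_comm, Complex.norm_mul_exp_arg_mul_I]

/-- On the points of the polyhedron without vanishing coordinates, the torus average of a
holomorphic function is constant, since the logarithmic image of these points is convex. -/
theorem torusAverage_eq {G : Matrix (Fin n) (Fin n) ℤ} {g : (Fin n → ℂ) → ℂ}
    (hU : IsOpen (integralPolyhedron G))
    (hg : DifferentiableOn ℂ g (integralPolyhedron G ∩ {z | ∀ k, z k ≠ 0}))
    {z z' : Fin n → ℂ} (hz : z ∈ integralPolyhedron G) (hz0 : ∀ k, z k ≠ 0)
    (hz' : z' ∈ integralPolyhedron G) (hz0' : ∀ k, z' k ≠ 0) :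
    torusAverage g z' = torusAverage g z := by
  set ξ : Fin n → ℝ := fun k => Real.log ‖z k‖ with hξ
  set ξ' : Fin n → ℝ := fun k => Real.log ‖z' k‖ with hξ'
  set M := G.map (Int.cast : ℤ → ℝ)
  obtain ⟨t, ht⟩ := exists_torusRotate_expCurve hz0 (ξ' - ξ)
  obtain ⟨t', ht'⟩ := exists_torusRotate_expCurve hz0' 0
  have hend : expCurve ξ' 0 0 = expCurve ξ (ξ' - ξ) 1 := by
    ext k; simp [expCurve]
  rw [ht', ht, torusAverage_torusRotate, torusAverage_torusRotate, ← hξ, ← hξ', hend]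
  have hne : ∀ (s : ℂ) k, expCurve ξ (ξ' - ξ) s k ≠ 0 := fun s k => Complex.exp_ne_zero _
  refine torusAverage_expCurve hg (hU.inter ?_) ?_ ?_
  · simp only [ofPred_forall]
    exact isOpen_iInter_of_finite fun k => isOpen_ne_fun (continuous_apply k) continuous_const
  · rintro t z ⟨h1, h2⟩
    exact ⟨(torusRotate_mem_integralPolyhedron t).2 h1,
      fun k => (torusRotate_eq_zero_iff t z k).not.2 (h2 k)⟩
  · intro x hx
    refine ⟨(mem_integralPolyhedron_iff (hne _)).2 fun j => ?_, hne _⟩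
    have h1 := (mem_integralPolyhedron_iff hz0).1 hz j
    have h2 := (mem_integralPolyhedron_iff hz0').1 hz' j
    have h3 : (fun k => Real.log ‖expCurve ξ (ξ' - ξ) x k‖) = (1 - x) • ξ + x • ξ' := by
      ext k
      rw [expCurve, Complex.norm_exp, Real.log_exp]
      simp
      ring
    rw [h3, Matrix.mulVec_add, Matrix.mulVec_smul, Matrix.mulVec_smul]
    change (1 - x) * M.mulVec ξ j + x * M.mulVec ξ' j < 0
    change M.mulVec ξ j < 0 at h1
    change M.mulVec ξ' j < 0 at h2
    rcases hx.1.eq_or_lt with h | h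
    · rw [← h]; simpa using h1
    · nlinarith [mul_pos h (neg_pos.2 h2), mul_nonneg (sub_nonneg.2 hx.2) (neg_pos.2 h1).le]

end Torus

/-! ### Square integrability of Laurent monomials -/

/-- The Cauchy–Schwarz inequality against the constant function `1`. -/
theorem sq_lintegral_le {X : Type*} [MeasurableSpace X] (μ : Measure X) {f : X → ENNReal}
    (hf : AEMeasurable f μ) : (∫⁻ x, f x ∂μ) ^ 2 ≤ μ univ * ∫⁻ x, f x ^ 2 ∂μ := by
  have h := ENNReal.lintegral_mul_le_Lp_mul_Lq μ Real.HolderConjugate.two_two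
    (aemeasurable_const (b := (1 : ENNReal))) hf
  simp only [Pi.mul_apply, one_mul, ENNReal.rpow_two, one_pow, lintegral_one] at h
  calc (∫⁻ x, f x ∂μ) ^ 2
      ≤ (μ univ ^ (1 / 2 : ℝ) * (∫⁻ x, f x ^ 2 ∂μ) ^ (1 / 2 : ℝ)) ^ 2 := by gcongr
    _ = _ := by
      rw [mul_pow, ← ENNReal.rpow_two, ← ENNReal.rpow_two, ← ENNReal.rpow_mul, ← ENNReal.rpow_mul]
      norm_num

/-- The Cauchy–Schwarz inequality for sums with weights `a`. -/
theorem sq_tsum_mul_le {ι : Type*} (a x : ι → ENNReal) :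
    (∑' i, a i * x i) ^ 2 ≤ (∑' i, a i) * ∑' i, a i * x i ^ 2 := by
  let _ : MeasurableSpace ι := ⊤
  have h := sq_lintegral_le (Measure.count.withDensity a) (f := x) measurable_from_top.aemeasurable
  rw [lintegral_withDensity_eq_lintegral_mul _ measurable_from_top measurable_from_top,
    lintegral_withDensity_eq_lintegral_mul _ measurable_from_top measurable_from_top,
    withDensity_apply _ MeasurableSet.univ, Measure.restrict_univ] at h
  simpa only [lintegral_count, Pi.mul_apply] using h

theorem memLp_two_iff_lintegral {X : Type*} [MeasurableSpace X] {μ : Measure X} {f : X → ℂ} :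
    MemLp f 2 μ ↔ AEStronglyMeasurable f μ ∧ ∫⁻ x, ‖f x‖ₑ ^ 2 ∂μ < ⊤ := by
  rw [MemLp, eLpNorm_lt_top_iff_lintegral_rpow_enorm_lt_top (by norm_num) (by norm_num)]
  simp

theorem ae_forall_ne_zero (n : ℕ) : ∀ᵐ z : Fin n → ℂ, ∀ k, z k ≠ 0 :=
  ae_all_iff.2 fun k => Measure.ae_eval_ne _ k 0

/-- If `G` were singular, the polyhedron would contain a curve `exp (ξ + s v)` with `G v = 0`, along
which a coordinate is unbounded. -/
theorem det_ne_zero_of_isBounded {n : ℕ} {G : Matrix (Fin n) (Fin n) ℤ}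
    (hU : IsOpen (integralPolyhedron G)) (hne : (integralPolyhedron G).Nonempty)
    (hb : Bornology.IsBounded (integralPolyhedron G)) : G.det ≠ 0 := by
  intro h0
  obtain ⟨z, hz, hz0⟩ := (Measure.dense_of_ae (ae_forall_ne_zero n)).inter_open_nonempty _ hU hne
  have hdet : (G.map (Int.cast : ℤ → ℝ)).det = 0 := by
    rw [← Int.cast_det, h0, Int.cast_zero]
  obtain ⟨v, hv0, hv⟩ := Matrix.exists_mulVec_eq_zero_iff.2 hdet
  obtain ⟨k, hk⟩ := Function.ne_iff.1 hv0
  obtain ⟨C, hC⟩ := hb.exists_norm_le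
  have hmem : ∀ s : ℝ, expCurve (fun k => Real.log ‖z k‖) v s ∈ integralPolyhedron G := by
    intro s
    have hne : ∀ i, expCurve (fun k => Real.log ‖z k‖) v s i ≠ 0 := fun _ => Complex.exp_ne_zero _
    refine (mem_integralPolyhedron_iff hne).2 fun j => ?_
    have h3 : (fun i => Real.log ‖expCurve (fun k => Real.log ‖z k‖) v s i‖) =
        (fun k => Real.log ‖z k‖) + s • v := by
      ext i
      rw [expCurve, Complex.norm_exp, Real.log_exp]
      simp
    rw [h3, Matrix.mulVec_add, Matrix.mulVec_smul, hv, smul_zero, add_zero]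
    exact (mem_integralPolyhedron_iff hz0).1 hz j
  have hbd : ∀ s : ℝ, Real.exp (Real.log ‖z k‖ + s * v k) ≤ C := by
    intro s
    refine le_trans (le_of_eq ?_) ((norm_le_pi_norm _ k).trans (hC _ (hmem s)))
    rw [expCurve, Complex.norm_exp]
    simp
  have hvk : v k ≠ 0 := hk
  -- Choose `s` so that the coordinate has absolute value `exp C > C`.
  have h1 := hbd ((C - Real.log ‖z k‖) / v k)
  rw [div_mul_cancel₀ _ hvk, add_sub_cancel] at h1
  linarith [Real.add_one_le_exp C]

/-- The coefficient of the monomial with exponent `α` in the Bergman kernel, which is the inverse of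
its squared norm when `α ∈ coneExponents G`. -/
noncomputable def monomialWeight {n : ℕ} (G : Matrix (Fin n) (Fin n) ℤ) (α : Fin n → ℤ) : ℝ :=
  |(G.map (Int.cast : ℤ → ℝ)).det| / Real.pi ^ n * ∏ j, coneCoord G (α + 1) j

section Norms

variable {n : ℕ} {G : Matrix (Fin n) (Fin n) ℤ}

theorem lintegral_sq_laurentMonomial (hG : G.det ≠ 0) (hU : IsOpen (integralPolyhedron G))
    (α : Fin n → ℤ) :
    ∫⁻ z in integralPolyhedron G, ‖laurentMonomial α z‖ₑ ^ 2 =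
      ENNReal.ofReal ((2 * Real.pi) ^ n) *
        (ENNReal.ofReal |(G.map (Int.cast : ℤ → ℝ)).det⁻¹| *
          ∏ j, ∫⁻ x in Iio (0 : ℝ), ENNReal.ofReal (Real.exp (2 * coneCoord G (α + 1) j * x))) := by
  set M := G.map (Int.cast : ℤ → ℝ) with hM
  set C : Set (Fin n → ℝ) := {x | ∀ j, M.mulVec x j < 0} with hC
  have hCm : MeasurableSet C := by
    rw [hC]
    simp only [ofPred_forall]
    refine MeasurableSet.iInter fun j => measurableSet_lt ?_ measurable_const
    unfold Matrix.mulVec dotProduct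
    fun_prop
  set g : (Fin n → ℝ) → ENNReal :=
    C.indicator fun x => ENNReal.ofReal (Real.exp (2 * ∑ k, (α k : ℝ) * x k)) with hg
  have hgm : Measurable g := Measurable.indicator (by fun_prop) hCm
  rw [← lintegral_exp_cone (det_map_intCast_ne_zero hG), ← lintegral_indicator hU.measurableSet]
  have h1 : ∫⁻ z, (integralPolyhedron G).indicator (fun z => ‖laurentMonomial α z‖ₑ ^ 2) z =
      ∫⁻ z : Fin n → ℂ, g (fun k => Real.log ‖z k‖) := by
    refine lintegral_congr_ae ?_
    filter_upwards [ae_forall_ne_zero n] with z hz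
    by_cases h : z ∈ integralPolyhedron G
    · have h' : (fun k => Real.log ‖z k‖) ∈ C := (mem_integralPolyhedron_iff hz).1 h
      rw [indicator_of_mem h, hg, indicator_of_mem h', ← ofReal_norm,
        norm_laurentMonomial_eq_exp _ hz, ← ENNReal.ofReal_pow (Real.exp_pos _).le,
        ← Real.exp_nat_mul]
      norm_num
    · have h' : (fun k => Real.log ‖z k‖) ∉ C := fun h' => h ((mem_integralPolyhedron_iff hz).2 h')
      rw [indicator_of_notMem h, hg, indicator_of_notMem h']
  rw [h1, lintegral_comp_log_norm hgm, ← lintegral_const_mul' _ _ ENNReal.ofReal_ne_top,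
    ← lintegral_indicator hCm]
  refine lintegral_congr fun x => ?_
  by_cases hx : x ∈ C
  · rw [hg, indicator_of_mem hx, indicator_of_mem hx, ← ENNReal.ofReal_prod_of_nonneg
      (fun _ _ => by positivity), ← ENNReal.ofReal_mul (by positivity),
      ← ENNReal.ofReal_mul (by positivity), Finset.prod_mul_distrib, Finset.prod_const,
      Finset.card_univ, Fintype.card_fin, ← Real.exp_sum, mul_assoc, ← Real.exp_add,
      Matrix.dotProduct_mulVec, vecMul_coneCoord hG]
    congr 3
    simp only [dotProduct, Pi.add_apply, Pi.one_apply, ← Finset.mul_sum, ← mul_add,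
      ← Finset.sum_add_distrib]
    congr 1
    refine Finset.sum_congr rfl fun k _ => ?_
    push_cast
    ring
  · rw [hg, indicator_of_notMem hx, indicator_of_notMem hx, mul_zero]

theorem monomialWeight_pos (hG : G.det ≠ 0) {α : Fin n → ℤ} (hα : α ∈ coneExponents G) :
    0 < monomialWeight G α :=
  mul_pos (div_pos (abs_pos.2 (det_map_intCast_ne_zero hG)) (by positivity))
    (Finset.prod_pos fun j _ => hα j)

theorem lintegral_sq_laurentMonomial_of_mem (hG : G.det ≠ 0)
    (hU : IsOpen (integralPolyhedron G)) {α : Fin n → ℤ} (hα : α ∈ coneExponents G) :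
    ∫⁻ z in integralPolyhedron G, ‖laurentMonomial α z‖ₑ ^ 2 =
      ENNReal.ofReal (monomialWeight G α)⁻¹ := by
  rw [lintegral_sq_laurentMonomial hG hU]
  have h : ∀ j, ∫⁻ x in Iio (0 : ℝ), ENNReal.ofReal (Real.exp (2 * coneCoord G (α + 1) j * x)) =
      ENNReal.ofReal (2 * coneCoord G (α + 1) j)⁻¹ := fun j =>
    lintegral_exp_Iio_of_pos (mul_pos two_pos (hα j))
  simp only [h]
  rw [← ENNReal.ofReal_prod_of_nonneg
      (fun j _ => inv_nonneg.2 (mul_nonneg zero_le_two (hα j).le)),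
    ← ENNReal.ofReal_mul (abs_nonneg _), ← ENNReal.ofReal_mul (by positivity), monomialWeight]
  congr 1
  rw [Finset.prod_inv_distrib, Finset.prod_mul_distrib, Finset.prod_const, Finset.card_univ,
    Fintype.card_fin, abs_inv, mul_pow, mul_inv, mul_inv, inv_div]
  have : Real.pi ≠ 0 := Real.pi_ne_zero
  field_simp

theorem lintegral_sq_laurentMonomial_of_notMem (hG : G.det ≠ 0)
    (hU : IsOpen (integralPolyhedron G)) {α : Fin n → ℤ} (hα : α ∉ coneExponents G) :
    ∫⁻ z in integralPolyhedron G, ‖laurentMonomial α z‖ₑ ^ 2 = ⊤ := by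
  rw [lintegral_sq_laurentMonomial hG hU]
  obtain ⟨j₀, hj₀⟩ : ∃ j, coneCoord G (α + 1) j ≤ 0 := by
    by_contra! h
    exact hα h
  have h : ∏ j, ∫⁻ x in Iio (0 : ℝ),
      ENNReal.ofReal (Real.exp (2 * coneCoord G (α + 1) j * x)) = ⊤ := by
    refine WithTop.prod_eq_top (Finset.mem_univ j₀)
      (lintegral_exp_Iio_of_nonpos (by linarith)) fun j _ => ?_
    rcases le_or_gt (coneCoord G (α + 1) j) 0 with h | h
    · rw [lintegral_exp_Iio_of_nonpos (by linarith)]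
      exact ENNReal.top_ne_zero
    · rw [lintegral_exp_Iio_of_pos (by linarith)]
      exact (ENNReal.ofReal_pos.2 (by positivity)).ne'
  rw [h, ENNReal.mul_top, ENNReal.mul_top]
  · exact (ENNReal.ofReal_pos.2 (by positivity)).ne'
  · exact (ENNReal.ofReal_pos.2 (abs_pos.2 (inv_ne_zero (det_map_intCast_ne_zero hG)))).ne'

theorem continuousOn_laurentMonomial {S : Set (Fin n → ℂ)} {α : Fin n → ℤ}
    (hα : ∀ z ∈ S, ∀ k, z k = 0 → 0 ≤ α k) : ContinuousOn (laurentMonomial α) S := by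
  refine continuousOn_finsetProd _ fun k _ => ?_
  refine (continuous_apply k).continuousOn.zpow₀ _ fun z hz => ?_
  by_cases h : z k = 0
  · exact Or.inr (hα z hz k h)
  · exact Or.inl h

theorem memLp_laurentMonomial (hG : G.det ≠ 0)
    (hU : IsOpen (integralPolyhedron G)) {α : Fin n → ℤ} (hα : α ∈ coneExponents G) :
    MemLp (laurentMonomial α) 2 (volume.restrict (integralPolyhedron G)) := by
  rw [memLp_two_iff_lintegral, lintegral_sq_laurentMonomial_of_mem hG hU hα]
  exact ⟨(continuousOn_laurentMonomial fun z hz k hk =>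
    nonneg_of_mem_coneExponents hG hα hz hk).aestronglyMeasurable hU.measurableSet,
    ENNReal.ofReal_lt_top⟩

theorem integral_sq_laurentMonomial (hG : G.det ≠ 0)
    (hU : IsOpen (integralPolyhedron G)) {α : Fin n → ℤ} (hα : α ∈ coneExponents G) :
    ∫ z in integralPolyhedron G, ‖laurentMonomial α z‖ ^ 2 = (monomialWeight G α)⁻¹ := by
  rw [integral_eq_lintegral_of_nonneg_ae (Filter.Eventually.of_forall fun _ => by positivity)
    (f := fun z => ‖laurentMonomial α z‖ ^ 2)
    ((memLp_laurentMonomial hG hU hα).1.norm.pow 2)]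
  simp only [ENNReal.ofReal_pow (norm_nonneg _), ofReal_norm]
  rw [lintegral_sq_laurentMonomial_of_mem hG hU hα,
    ENNReal.toReal_ofReal (inv_nonneg.2 (monomialWeight_pos hG hα).le)]

/-- The weights are bounded away from zero, because `det G` times a cone
coordinate is a nonzero integer. -/
theorem exists_le_monomialWeight (hG : G.det ≠ 0) :
    ∃ ε > 0, ∀ α ∈ coneExponents G, ε ≤ monomialWeight G α := by
  have hdet : (0 : ℝ) < |(G.map (Int.cast : ℤ → ℝ)).det| :=
    abs_pos.2 (det_map_intCast_ne_zero hG)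
  refine ⟨|(G.map (Int.cast : ℤ → ℝ)).det| / Real.pi ^ n *
    ∏ _j : Fin n, |(G.map (Int.cast : ℤ → ℝ)).det|⁻¹, by positivity, fun α hα => ?_⟩
  refine mul_le_mul_of_nonneg_left (Finset.prod_le_prod (fun _ _ => by positivity)
    fun j _ => ?_) (by positivity)
  have h1 : coneCoord G (α + 1) j * (G.map (Int.cast : ℤ → ℝ)).det =
      ((Matrix.vecMul (α + 1) G.adjugate j : ℤ) : ℝ) := by
    have hadj : (G.map (Int.cast : ℤ → ℝ)).adjugate = G.adjugate.map (Int.cast : ℤ → ℝ) :=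
      ((Int.castRingHom ℝ).map_adjugate G).symm
    rw [coneCoord, Matrix.inv_def, Matrix.vecMul_smul, hadj, Ring.inverse_eq_inv', Pi.smul_apply,
      smul_eq_mul, mul_comm, mul_inv_cancel_left₀ (det_map_intCast_ne_zero hG)]
    simp [Matrix.vecMul, dotProduct]
  have h2 : Matrix.vecMul (α + 1) G.adjugate j ≠ 0 := by
    intro h
    rw [h, Int.cast_zero] at h1
    exact (mul_ne_zero (hα j).ne' (det_map_intCast_ne_zero hG)) h1
  have h3 : (1 : ℝ) ≤ |coneCoord G (α + 1) j * (G.map (Int.cast : ℤ → ℝ)).det| := by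
    rw [h1, ← Int.cast_abs]
    exact_mod_cast Int.one_le_abs h2
  rw [abs_mul, abs_of_pos (hα j)] at h3
  rw [inv_le_iff_one_le_mul₀ hdet]
  exact h3

end Norms

/-! ### Fourier coefficients along torus orbits -/

/-- The Fourier coefficient with index `α` of the function `t ↦ f (torusRotate t z)` on the
torus; it is definitionally `UnitAddTorus.mFourierCoeff`. -/
noncomputable def torusCoeff {n : ℕ} (f : (Fin n → ℂ) → ℂ) (α : Fin n → ℤ) (z : Fin n → ℂ) : ℂ :=
  ∫ t, UnitAddTorus.mFourier (-α) t * f (torusRotate t z) ∂torusMeasure n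

section Coeff

variable {n : ℕ} {G : Matrix (Fin n) (Fin n) ℤ} {f : (Fin n → ℂ) → ℂ}

theorem mFourier_neg_mul_mFourier (α : Fin n → ℤ) (t : UnitAddTorus (Fin n)) :
    UnitAddTorus.mFourier (-α) t * UnitAddTorus.mFourier α t = 1 := by
  rw [← UnitAddTorus.mFourier_add, neg_add_cancel, UnitAddTorus.mFourier_zero,
    ContinuousMap.one_apply]

theorem torusCoeff_eq_mul_torusAverage (f : (Fin n → ℂ) → ℂ) (α : Fin n → ℤ) {z : Fin n → ℂ}
    (hz : ∀ k, z k ≠ 0) :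
    torusCoeff f α z =
      torusAverage (fun z => f z * (laurentMonomial α z)⁻¹) z * laurentMonomial α z := by
  rw [torusCoeff, torusAverage, ← integral_mul_const]
  congr 1
  ext t
  have h1 := mFourier_neg_mul_mFourier α t
  have h2 : UnitAddTorus.mFourier α t ≠ 0 := right_ne_zero_of_mul_eq_one h1
  have h3 := laurentMonomial_ne_zero α hz
  rw [laurentMonomial_torusRotate, eq_inv_of_mul_eq_one_left h1]
  field_simp

theorem continuousOn_torusCoeff (hU : IsOpen (integralPolyhedron G))
    (hf : ContinuousOn f (integralPolyhedron G)) (α : Fin n → ℤ) :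
    ContinuousOn (torusCoeff f α) (integralPolyhedron G) := by
  rw [continuousOn_iff_continuous_domRestrict]
  have : LocallyCompactSpace (integralPolyhedron G) :=
    hU.isOpenEmbedding_subtypeVal.locallyCompactSpace
  have h1 : Continuous fun p : integralPolyhedron G × UnitAddTorus (Fin n) =>
      UnitAddTorus.mFourier (-α) p.2 * f (torusRotate p.2 p.1) := by
    refine ((UnitAddTorus.mFourier (-α)).continuous.comp continuous_snd).mul ?_
    have := continuousOn_comp_torusRotate hf
      (fun t z => (torusRotate_mem_integralPolyhedron t).2)
      (S := univ) (φ := fun z : integralPolyhedron G => z.1) continuous_subtype_val.continuousOn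
      (fun z _ => z.2)
    rwa [univ_prod_univ, continuousOn_univ] at this
  have h2 := continuous_parametric_integral_of_continuous (μ := torusMeasure n)
    (f := fun (z : integralPolyhedron G) t =>
      UnitAddTorus.mFourier (-α) t * f (torusRotate t z)) h1 isCompact_univ
  simp only [Measure.restrict_univ] at h2
  exact h2

theorem exists_torusCoeff_eq (hU : IsOpen (integralPolyhedron G))
    (hne : (integralPolyhedron G).Nonempty)
    (hf : DifferentiableOn ℂ f (integralPolyhedron G)) (α : Fin n → ℤ) :
    ∃ a : ℂ, ∀ z ∈ integralPolyhedron G, (∀ k, z k ≠ 0) →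
      torusCoeff f α z = a * laurentMonomial α z := by
  obtain ⟨z₀, hz₀, hz₀'⟩ :=
    (Measure.dense_of_ae (ae_forall_ne_zero n)).inter_open_nonempty _ hU hne
  refine ⟨torusAverage (fun z => f z * (laurentMonomial α z)⁻¹) z₀, fun z hz hz' => ?_⟩
  rw [torusCoeff_eq_mul_torusAverage f α hz']
  congr 1
  refine torusAverage_eq hU ?_ hz₀ hz₀' hz hz'
  refine (hf.mono inter_subset_left).mul (DifferentiableOn.inv ?_ fun z hz =>
    laurentMonomial_ne_zero α hz.2)
  intro z hz
  have hk : ∀ k ∈ Finset.univ, DifferentiableAt ℂ (fun w : Fin n → ℂ => w k ^ α k) z := fun k _ =>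
    (differentiableAt_apply k z).zpow (Or.inl (hz.2 k))
  exact (HasFDerivAt.finsetProd
    fun k hk' => (hk k hk').hasFDerivAt).differentiableAt.differentiableWithinAt

/-- Points without vanishing coordinates are dense in the polyhedron. -/
theorem eqOn_of_eqOn_ne_zero (hU : IsOpen (integralPolyhedron G)) {g h : (Fin n → ℂ) → ℂ}
    (hg : ContinuousOn g (integralPolyhedron G)) (hh : ContinuousOn h (integralPolyhedron G))
    (hgh : ∀ z ∈ integralPolyhedron G, (∀ k, z k ≠ 0) → g z = h z) :
    ∀ z ∈ integralPolyhedron G, g z = h z := by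
  have : EqOn g h (integralPolyhedron G ∩ {z | ∀ k, z k ≠ 0}) := fun z hz => hgh z hz.1 hz.2
  exact this.of_subset_closure hg hh inter_subset_left
    ((Measure.dense_of_ae (ae_forall_ne_zero n)).open_subset_closure_inter hU)

theorem measurable_torusRotate :
    Measurable (Function.uncurry (torusRotate : UnitAddTorus (Fin n) → (Fin n → ℂ) → _)) := by
  refine measurable_pi_lambda _ fun k => ?_
  have : Measurable fun p : UnitAddTorus (Fin n) × (Fin n → ℂ) =>
      (AddCircle.toCircle (p.1 k) : ℂ) :=
    (continuous_subtype_val.comp AddCircle.continuous_toCircle).measurable.comp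
      ((measurable_pi_apply k).comp measurable_fst)
  exact this.mul ((measurable_pi_apply k).comp measurable_snd)

/-- The skew product `(t, z) ↦ (t, torusRotate t z)` preserves the product measure. -/
theorem integral_torusAverage {h : (Fin n → ℂ) → ℂ} (hh : Integrable h) :
    ∫ z, torusAverage h z = ∫ z, h z := by
  have hsk : MeasurePreserving
      (fun p : UnitAddTorus (Fin n) × (Fin n → ℂ) => (p.1, torusRotate p.1 p.2))
      ((torusMeasure n).prod volume) ((torusMeasure n).prod volume) :=
    (MeasurePreserving.id _).skew_product measurable_torusRotate
      (Filter.Eventually.of_forall fun t => (measurePreserving_torusRotate t).map_eq)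
  have h1 : Integrable (fun p : UnitAddTorus (Fin n) × (Fin n → ℂ) => h (torusRotate p.1 p.2))
      ((torusMeasure n).prod volume) :=
    hsk.integrable_comp_of_integrable (hh.comp_snd (torusMeasure n))
  have h2 := integral_integral_swap (f := fun t z => h (torusRotate t z)) h1
  have h3 : ∀ t : UnitAddTorus (Fin n), ∫ z, h (torusRotate t z) = ∫ z, h z := by
    intro t
    have hm := measurePreserving_torusRotate t
    have := integral_map (f := h) hm.measurable.aemeasurable
      (by rw [hm.map_eq]; exact hh.aestronglyMeasurable)
    rw [hm.map_eq] at this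
    exact this.symm
  simp only [torusAverage, ← h2, h3, integral_const, probReal_univ, one_smul]

theorem lintegral_lintegral_torusRotate {φ : (Fin n → ℂ) → ENNReal} (hφ : Measurable φ) :
    ∫⁻ z, ∫⁻ t, φ (torusRotate t z) ∂torusMeasure n = ∫⁻ z, φ z := by
  rw [lintegral_lintegral_swap]
  · have h3 : ∀ t : UnitAddTorus (Fin n), ∫⁻ z, φ (torusRotate t z) = ∫⁻ z, φ z := fun t =>
      (measurePreserving_torusRotate t).lintegral_comp hφ
    simp [h3]
  · exact (hφ.comp (measurable_torusRotate.comp measurable_swap)).aemeasurable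

theorem measurable_indicator_of_continuousOn (hU : IsOpen (integralPolyhedron G))
    (hf : ContinuousOn f (integralPolyhedron G)) :
    Measurable ((integralPolyhedron G).indicator f) := by
  classical
  rw [← piecewise_eq_indicator]
  exact hf.measurable_piecewise continuousOn_const hU.measurableSet

theorem lintegral_sq_torusCoeff_le (hU : IsOpen (integralPolyhedron G))
    (hf : ContinuousOn f (integralPolyhedron G)) (α : Fin n → ℤ) :
    ∫⁻ z in integralPolyhedron G, ‖torusCoeff f α z‖ₑ ^ 2 ≤
      ∫⁻ z in integralPolyhedron G, ‖f z‖ₑ ^ 2 := by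
  set F := (integralPolyhedron G).indicator f with hF
  have hFm : Measurable F := measurable_indicator_of_continuousOn hU hf
  calc ∫⁻ z in integralPolyhedron G, ‖torusCoeff f α z‖ₑ ^ 2
      ≤ ∫⁻ z in integralPolyhedron G, ∫⁻ t, ‖F (torusRotate t z)‖ₑ ^ 2 ∂torusMeasure n := by
        refine setLIntegral_mono' hU.measurableSet fun z hz => ?_
        have h1 : ‖torusCoeff f α z‖ₑ ≤ ∫⁻ t, ‖F (torusRotate t z)‖ₑ ∂torusMeasure n := by
          refine (enorm_integral_le_lintegral_enorm _).trans (lintegral_mono fun t => ?_)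
          rw [enorm_mul, hF, indicator_of_mem ((torusRotate_mem_integralPolyhedron t).2 hz)]
          refine mul_le_of_le_one_left' ?_
          rw [← ofReal_norm, ← ENNReal.ofReal_one]
          exact ENNReal.ofReal_le_ofReal (((UnitAddTorus.mFourier (-α)).norm_coe_le_norm t).trans
            UnitAddTorus.mFourier_norm.le)
        have hm : Measurable fun t : UnitAddTorus (Fin n) => ‖F (torusRotate t z)‖ₑ :=
          (hFm.comp (measurable_torusRotate.comp
            (measurable_id.prodMk measurable_const))).enorm
        calc ‖torusCoeff f α z‖ₑ ^ 2 ≤ (∫⁻ t, ‖F (torusRotate t z)‖ₑ ∂torusMeasure n) ^ 2 := by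
              gcongr
          _ ≤ torusMeasure n univ * ∫⁻ t, ‖F (torusRotate t z)‖ₑ ^ 2 ∂torusMeasure n :=
              sq_lintegral_le _ hm.aemeasurable
          _ = _ := by rw [measure_univ, one_mul]
    _ ≤ ∫⁻ z, ∫⁻ t, ‖F (torusRotate t z)‖ₑ ^ 2 ∂torusMeasure n := setLIntegral_le_lintegral _ _
    _ = ∫⁻ z, ‖F z‖ₑ ^ 2 := lintegral_lintegral_torusRotate (φ := fun z => ‖F z‖ₑ ^ 2)
        (hFm.enorm.pow_const 2)
    _ = ∫⁻ z in integralPolyhedron G, ‖f z‖ₑ ^ 2 := by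
        rw [← lintegral_indicator hU.measurableSet]
        refine lintegral_congr fun z => ?_
        by_cases hz : z ∈ integralPolyhedron G
        · rw [hF, indicator_of_mem hz, indicator_of_mem hz]
        · rw [hF, indicator_of_notMem hz, indicator_of_notMem hz]
          simp

/-- A Laurent monomial that is not square integrable does not occur in a function of the Bergman
space, because the `α`-th Fourier component `a * z ^ α` of `f` has norm at most that of `f`. -/
theorem torusCoeff_eq_zero (hG : G.det ≠ 0) (hU : IsOpen (integralPolyhedron G))
    (hf : MemBergmanSpace (integralPolyhedron G) f) {α : Fin n → ℤ} (hα : α ∉ coneExponents G)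
    {z : Fin n → ℂ} (hz : z ∈ integralPolyhedron G) : torusCoeff f α z = 0 := by
  obtain ⟨a, ha⟩ := exists_torusCoeff_eq hU ⟨z, hz⟩ hf.differentiableOn α
  have h1 := lintegral_sq_torusCoeff_le hU hf.differentiableOn.continuousOn α
  have h2 : ∫⁻ z in integralPolyhedron G, ‖torusCoeff f α z‖ₑ ^ 2 = ‖a‖ₑ ^ 2 * ⊤ := by
    rw [← lintegral_sq_laurentMonomial_of_notMem hG hU hα, ← lintegral_const_mul' _ _ (by simp)]
    refine lintegral_congr_ae ?_
    filter_upwards [ae_restrict_mem hU.measurableSet, ae_restrict_of_ae (ae_forall_ne_zero n)]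
      with w hw hw'
    rw [ha w hw hw', enorm_mul, mul_pow]
  have ha0 : a = 0 := by
    by_contra h
    rw [h2, ENNReal.mul_top (by simpa using h)] at h1
    exact (h1.trans_lt (memLp_two_iff_lintegral.1 hf.memLp).2).ne rfl
  refine eqOn_of_eqOn_ne_zero hU (continuousOn_torusCoeff hU hf.differentiableOn.continuousOn α)
    continuousOn_const (fun w hw hw' => ?_) z hz
  rw [ha w hw hw', ha0, zero_mul]

theorem integrable_mul_conj_laurentMonomial (hG : G.det ≠ 0) (hU : IsOpen (integralPolyhedron G))
    (hf : MemBergmanSpace (integralPolyhedron G) f) {α : Fin n → ℤ} (hα : α ∈ coneExponents G) :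
    Integrable (fun z => f z * conj (laurentMonomial α z))
      (volume.restrict (integralPolyhedron G)) := by
  have h := (memLp_laurentMonomial hG hU hα).star
  exact hf.memLp.integrable_mul h

theorem torusCoeff_eq (hG : G.det ≠ 0) (hU : IsOpen (integralPolyhedron G))
    (hf : MemBergmanSpace (integralPolyhedron G) f) {α : Fin n → ℤ} (hα : α ∈ coneExponents G)
    {z : Fin n → ℂ} (hz : z ∈ integralPolyhedron G) :
    torusCoeff f α z = monomialWeight G α * laurentMonomial α z *
      ∫ z in integralPolyhedron G, f z * conj (laurentMonomial α z) := by
  obtain ⟨a, ha⟩ := exists_torusCoeff_eq hU ⟨z, hz⟩ hf.differentiableOn α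
  have ha' : ∀ z ∈ integralPolyhedron G, torusCoeff f α z = a * laurentMonomial α z :=
    eqOn_of_eqOn_ne_zero hU (continuousOn_torusCoeff hU hf.differentiableOn.continuousOn α)
      (continuousOn_const.mul (continuousOn_laurentMonomial fun z hz k hk =>
        nonneg_of_mem_coneExponents hG hα hz hk)) ha
  have hI : ∫ z in integralPolyhedron G, f z * conj (laurentMonomial α z) =
      a * ((monomialWeight G α)⁻¹ : ℝ) := by
    rw [← integral_sq_laurentMonomial hG hU hα, ← integral_complex_ofReal, ← integral_const_mul,
      ← integral_indicator hU.measurableSet, ← integral_torusAverage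
        ((integrable_indicator_iff hU.measurableSet).2
          (integrable_mul_conj_laurentMonomial hG hU hf hα)),
      ← integral_indicator hU.measurableSet]
    congr 1
    ext w
    by_cases hw : w ∈ integralPolyhedron G
    · rw [indicator_of_mem hw, torusAverage]
      have : ∀ t : UnitAddTorus (Fin n), (integralPolyhedron G).indicator
          (fun z => f z * conj (laurentMonomial α z)) (torusRotate t w) =
          UnitAddTorus.mFourier (-α) t * f (torusRotate t w) * conj (laurentMonomial α w) := by
        intro t
        rw [indicator_of_mem ((torusRotate_mem_integralPolyhedron t).2 hw),
          laurentMonomial_torusRotate, map_mul, ← UnitAddTorus.mFourier_neg]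
        ring
      simp only [this]
      rw [integral_mul_const, ← torusCoeff, ha' w hw, mul_assoc, Complex.mul_conj,
        Complex.normSq_eq_norm_sq]
    · rw [indicator_of_notMem hw, torusAverage]
      have : ∀ t : UnitAddTorus (Fin n), (integralPolyhedron G).indicator
          (fun z => f z * conj (laurentMonomial α z)) (torusRotate t w) = 0 := fun t =>
        indicator_of_notMem (fun h => hw ((torusRotate_mem_integralPolyhedron t).1 h)) _
      simp [this]
  have hw : (monomialWeight G α : ℂ) ≠ 0 := by
    exact_mod_cast (monomialWeight_pos hG hα).ne'
  rw [ha' z hz, hI]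
  push_cast
  field_simp

end Coeff

/-! ### The Bergman kernel -/

/-- The Bergman kernel of `integralPolyhedron G` in closed form. -/
noncomputable def polyhedralKernel {n : ℕ} (G : Matrix (Fin n) (Fin n) ℤ) (z w : Fin n → ℂ) : ℂ :=
  ((|(G.map (Int.cast : ℤ → ℝ)).det| / Real.pi ^ n : ℝ) : ℂ) *
    coneSum G (z * fun k => conj (w k))

section Kernel

variable {n : ℕ} {G : Matrix (Fin n) (Fin n) ℤ}

theorem hasSum_polyhedralKernel (hG : G.det ≠ 0) {z w : Fin n → ℂ}
    (hz : z ∈ integralPolyhedron G) (hw : w ∈ integralPolyhedron G) :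
    HasSum (fun α : coneExponents G => (monomialWeight G α.1 : ℂ) *
      (laurentMonomial α.1 z * conj (laurentMonomial α.1 w))) (polyhedralKernel G z w) := by
  refine ((hasSum_coneSum hG (mul_conj_mem_integralPolyhedron hz hw)).mul_left
    ((|(G.map (Int.cast : ℤ → ℝ)).det| / Real.pi ^ n : ℝ) : ℂ)).congr_fun fun α => ?_
  rw [laurentMonomial_mul, laurentMonomial_conj, monomialWeight]
  push_cast
  ring

theorem summable_weight_mul_norm (hG : G.det ≠ 0) {w : Fin n → ℂ}
    (hw : w ∈ integralPolyhedron G) :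
    Summable fun α : coneExponents G => monomialWeight G α.1 * ‖laurentMonomial α.1 w‖ := by
  refine ((hasSum_coneSum hG hw).summable.norm.mul_left
    (|(G.map (Int.cast : ℤ → ℝ)).det| / Real.pi ^ n)).congr fun α => ?_
  rw [norm_mul, monomialWeight, norm_prod, mul_assoc]
  congr 2
  exact Finset.prod_congr rfl fun j _ => by
    rw [Complex.norm_real, Real.norm_of_nonneg (α.2 j).le]

theorem summable_norm_laurentMonomial (hG : G.det ≠ 0) {w : Fin n → ℂ}
    (hw : w ∈ integralPolyhedron G) :
    Summable fun α : coneExponents G => ‖laurentMonomial α.1 w‖ := by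
  obtain ⟨ε, hε, h⟩ := exists_le_monomialWeight hG
  refine Summable.of_nonneg_of_le (fun _ => norm_nonneg _) (fun α => ?_)
    ((summable_weight_mul_norm hG hw).mul_left ε⁻¹)
  rw [← mul_assoc, ← div_eq_inv_mul]
  exact le_mul_of_one_le_left (norm_nonneg _) ((one_le_div hε).2 (h α.1 α.2))

theorem memBergmanSpace_polyhedralKernel (hG : G.det ≠ 0) (hU : IsOpen (integralPolyhedron G))
    {w : Fin n → ℂ} (hw : w ∈ integralPolyhedron G) :
    MemBergmanSpace (integralPolyhedron G) fun z => polyhedralKernel G z w := by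
  have hd : DifferentiableOn ℂ (fun z => polyhedralKernel G z w) (integralPolyhedron G) :=
    ((isSesquiRationalOn_coneSum hG).differentiableOn hw).const_mul _
  refine ⟨hd, memLp_two_iff_lintegral.2
    ⟨hd.continuousOn.aestronglyMeasurable hU.measurableSet, ?_⟩⟩
  set a : coneExponents G → ENNReal := fun α =>
    ENNReal.ofReal (monomialWeight G α.1 * ‖laurentMonomial α.1 w‖) with ha
  have hnn : ∀ α : coneExponents G, 0 ≤ monomialWeight G α.1 * ‖laurentMonomial α.1 w‖ :=
    fun α => mul_nonneg (monomialWeight_pos hG α.2).le (norm_nonneg _)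
  have hpt : ∀ z ∈ integralPolyhedron G, ‖polyhedralKernel G z w‖ₑ ^ 2 ≤
      (∑' α, a α) * ∑' α : coneExponents G, a α * ‖laurentMonomial α.1 z‖ₑ ^ 2 := by
    intro z hz
    refine le_trans ?_ (sq_tsum_mul_le a _)
    gcongr
    rw [← (hasSum_polyhedralKernel hG hz hw).tsum_eq]
    refine enorm_tsum_le_tsum_enorm.trans (ENNReal.tsum_le_tsum fun α => le_of_eq ?_)
    rw [ha, ← ofReal_norm, ← ofReal_norm, ← ENNReal.ofReal_mul (hnn α), norm_mul, norm_mul,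
      RCLike.norm_conj, Complex.norm_real, Real.norm_of_nonneg (monomialWeight_pos hG α.2).le]
    congr 1
    ring
  -- The factor `‖z ^ α‖²` integrates to the inverse of the weight, which cancels.
  have hint : ∫⁻ z in integralPolyhedron G,
      (∑' α, a α) * ∑' α : coneExponents G, a α * ‖laurentMonomial α.1 z‖ₑ ^ 2 =
      (∑' α, a α) * ∑' α : coneExponents G, ENNReal.ofReal ‖laurentMonomial α.1 w‖ := by
    have ham : ∀ α : coneExponents G,
        AEMeasurable (fun z => a α * ‖laurentMonomial α.1 z‖ₑ ^ 2)
          (volume.restrict (integralPolyhedron G)) := fun α =>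
      ((memLp_laurentMonomial hG hU α.2).1.enorm.pow_const 2).const_mul _
    rw [lintegral_const_mul' _ _ (summable_weight_mul_norm hG hw).tsum_ofReal_ne_top,
      lintegral_tsum ham]
    congr 2
    ext α
    rw [lintegral_const_mul' _ _ ENNReal.ofReal_ne_top,
      lintegral_sq_laurentMonomial_of_mem hG hU α.2, ← ENNReal.ofReal_mul (hnn α)]
    congr 1
    have := (monomialWeight_pos hG α.2).ne'
    field_simp
  refine (setLIntegral_mono' hU.measurableSet hpt).trans_lt ?_
  rw [hint]
  exact ENNReal.mul_lt_top (summable_weight_mul_norm hG hw).tsum_ofReal_lt_top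
    (summable_norm_laurentMonomial hG hw).tsum_ofReal_lt_top

/-- Integrating `f` against the kernel term by term gives the Fourier coefficients of `f` on the
orbit of `w`. -/
theorem hasSum_integral_polyhedralKernel (hG : G.det ≠ 0)
    (hU : IsOpen (integralPolyhedron G)) {f : (Fin n → ℂ) → ℂ}
    (hf : MemBergmanSpace (integralPolyhedron G) f) {w : Fin n → ℂ}
    (hw : w ∈ integralPolyhedron G) :
    HasSum (fun α : coneExponents G => torusCoeff f α.1 w)
        (∫ z in integralPolyhedron G, f z * conj (polyhedralKernel G z w)) := by
  have hF2 : Integrable (fun z => ‖f z‖ ^ 2) (volume.restrict (integralPolyhedron G)) :=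
    (memLp_two_iff_integrable_sq_norm hf.memLp.1).1 hf.memLp
  set A := ∫ z in integralPolyhedron G, ‖f z‖ ^ 2 with hA
  set F : coneExponents G → (Fin n → ℂ) → ℂ := fun α z =>
    (monomialWeight G α.1 * laurentMonomial α.1 w) * (f z * conj (laurentMonomial α.1 z)) with hF
  have h1 : ∀ α, Integrable (F α) (volume.restrict (integralPolyhedron G)) := fun α =>
    (integrable_mul_conj_laurentMonomial hG hU hf α.2).const_mul _
  have h2 : Summable fun α => ∫ z in integralPolyhedron G, ‖F α z‖ := by
    refine Summable.of_nonneg_of_le (fun α => integral_nonneg fun _ => norm_nonneg _) (fun α => ?_)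
      (((summable_weight_mul_norm hG hw).mul_left A).add (summable_norm_laurentMonomial hG hw))
    have hc := monomialWeight_pos hG α.2
    have hle : ∫ z in integralPolyhedron G, ‖f z * conj (laurentMonomial α.1 z)‖ ≤
        A + (monomialWeight G α.1)⁻¹ := by
      have hL2 := (memLp_two_iff_integrable_sq_norm (memLp_laurentMonomial hG hU α.2).1).1
        (memLp_laurentMonomial hG hU α.2)
      rw [hA, ← integral_sq_laurentMonomial hG hU α.2, ← integral_add hF2 hL2]
      refine integral_mono (integrable_mul_conj_laurentMonomial hG hU hf α.2).norm
        (hF2.add hL2) fun z => ?_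
      simp only [norm_mul, RCLike.norm_conj]
      -- `|f| |z ^ α| ≤ |f|² + |z ^ α|²`
      nlinarith [sq_nonneg (‖f z‖ - ‖laurentMonomial α.1 z‖), sq_nonneg ‖f z‖,
        sq_nonneg ‖laurentMonomial α.1 z‖]
    simp only [hF, norm_mul _ (f _ * _)]
    rw [integral_const_mul, norm_mul, Complex.norm_real, Real.norm_of_nonneg hc.le]
    calc monomialWeight G α.1 * ‖laurentMonomial α.1 w‖ *
          ∫ z in integralPolyhedron G, ‖f z * conj (laurentMonomial α.1 z)‖
        ≤ monomialWeight G α.1 * ‖laurentMonomial α.1 w‖ * (A + (monomialWeight G α.1)⁻¹) := by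
          gcongr
      _ = _ := by field_simp
  have h3 := hasSum_integral_of_summable_integral_norm h1 h2
  have h4 : ∫ z in integralPolyhedron G, f z * conj (polyhedralKernel G z w) =
      ∫ z in integralPolyhedron G, ∑' α, F α z := by
    refine setIntegral_congr_fun hU.measurableSet fun z hz => ?_
    have hs := ((Complex.hasSum_conj'.2 (hasSum_polyhedralKernel hG hz hw)).mul_left (f z)).tsum_eq
    simp only [← hs, hF]
    refine tsum_congr fun α => ?_
    simp only [map_mul, Complex.conj_conj, Complex.conj_ofReal]
    ring
  rw [h4]
  refine h3.congr_fun fun α => ?_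
  rw [torusCoeff_eq hG hU hf α.2 hw, hF, integral_const_mul]

theorem isBergmanKernel_polyhedralKernel (hG : G.det ≠ 0)
    (hU : IsOpen (integralPolyhedron G)) :
    IsBergmanKernel (integralPolyhedron G) (polyhedralKernel G) := by
  refine ⟨fun w hw => memBergmanSpace_polyhedralKernel hG hU hw, fun w hw f hf => ?_⟩
  have h1 := hasSum_integral_polyhedralKernel hG hU hf hw
  have h2 : HasSum (fun α => torusCoeff f α w)
      (∫ z in integralPolyhedron G, f z * conj (polyhedralKernel G z w)) := by
    refine (hasSum_subtype_iff_of_support_subset (s := coneExponents G) fun α hα => ?_).1 h1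
    by_contra h
    exact hα (torusCoeff_eq_zero hG hU hf h hw)
  have hcont : Continuous fun t : UnitAddTorus (Fin n) => f (torusRotate t w) := by
    refine hf.differentiableOn.continuousOn.comp_continuous
      (continuous_torusRotate.comp (continuous_id.prodMk continuous_const))
      fun t => (torusRotate_mem_integralPolyhedron t).2 hw
  -- The Fourier series at `t = 0` converges because the integrated series does.
  have h3 := UnitAddTorus.hasSum_mFourier_series_apply_of_summable
    (f := ⟨fun t => f (torusRotate t w), hcont⟩) h2.summable 0
  have h4 : ∀ α : Fin n → ℤ, UnitAddTorus.mFourier α (0 : UnitAddTorus (Fin n)) = 1 := fun α => by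
    simp [UnitAddTorus.mFourier]
  simp only [h4, smul_eq_mul, mul_one, ContinuousMap.coe_mk, torusRotate_zero] at h3
  exact h3.unique h2

end Kernel

theorem proposition3p7 {n : ℕ} (hn : 2 ≤ n) (U : Set (Fin n → ℂ))
    (hU : IsMonomialPolyhedron U) (hbdd : Bornology.IsBounded U) :
    IsBergmanKernel U (bergmanKernel U) ∧ IsSesquiRationalOn U (bergmanKernel U) := by
  obtain ⟨b, hb⟩ := hU.exists_eq
  obtain ⟨G, hbG⟩ := exists_integralPolyhedron_eq b
  obtain rfl : U = integralPolyhedron G := hb.trans hbG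
  have hG := det_ne_zero_of_isBounded hU.isOpen hU.isConnected.nonempty hbdd
  have hK := isBergmanKernel_polyhedralKernel hG hU.isOpen
  have hex : ∃ K, IsBergmanKernel (integralPolyhedron G) K := ⟨_, hK⟩
  have hB : IsBergmanKernel (integralPolyhedron G) (bergmanKernel (integralPolyhedron G)) := by
    rw [bergmanKernel, dif_pos hex]
    exact hex.choose_spec
  exact ⟨hB, ((IsSesquiRationalOn.const _).mul (isSesquiRationalOn_coneSum hG)).congr
    (hB.unique hK)⟩
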